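/- **Theorem (Max-Cut).** *Setting.* An instance is a loop-free undirected graph $G$ on $n$ nodes with edge weights in $[0,1]$ (unweighted graphs are the case of weights in $\{0,1\}$), with Laplacian $L_G=D-A$. A solution is a vector $s\in\{\pm1\}^n$, with cost $L(s;G)=-s^\top L_G s$ (that is, $-4$ times the weight of the cut given by $s$). Let the features be $\psi_S(s)=(ss^\top)^\flat\in\mathbb R^{n^2}$ and $\psi_{\mathcal I}(G)=(-L_G)^\flat\in\mathbb R^{n^2}$. For $W\in\mathbb R^{n^2\times n^2}$ let $\phi(s;G;W)\propto\exp(\psi_{\mathcal I}(G)^\top W\,\psi_S(s))$ on $\{\pm1\}^n$. For $\beta,\rho\in(0,1)$ and $B>0$ the solution generator is the family $$p(W)=(1-\beta)\,\phi(W)+\beta\,\phi(\rho W),\qquad W\in\mathcal W=\{W:\|W\|_F\le B\}.$$ For a prior (Borel probability measure) $\mathcal R$ on the instances let $$\mathcal L(W)=\mathbb E_{G\sim\mathcal R}\,\mathbb E_{s\sim p(\cdot;G;W)}[L(s;G)],\qquad \mathrm{opt}=\mathbb E_{G\sim\mathcal R}\big[\min_s L(s;G)\big],$$ $$H(W)=\mathbb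 E_{G\sim\mathcal R}\,\mathbb E_{s\sim\phi(\cdot;G;W)}[\log\phi(s;G;W)],\quad R(W)=(1-\beta)H(W)+\tfrac{\beta}{\rho}H(\rho W),\quad \mathcal L_\lambda=\mathcal L+\lambda R .$$ *Projected SGD* on $\mathcal L_\lambda$ with step size $\eta>0$ and starting point $W_0\in\mathcal W$ is the Markov chain $W_{t+1}=\Pi_{\mathcal W}(W_t-\eta g_t)$, where $\Pi_{\mathcal W}$ is the Euclidean projection onto $\mathcal W$ and $g_t$ is the policy-gradient estimate from one fresh sample: draw $G\sim\mathcal R$, draw $\theta=1$ with probability $1-\beta$ and $\theta=\rho$ with probability $\beta$, draw $s\sim\phi(\cdot;G;\theta W_t)$, and set $$g_t=\Big(L(s;G)+\tfrac{\lambda}{\theta}\log\phi(s;G;\theta W_t)\Big)\,\nabla_W\log\phi(s;G;\theta W)\big|_{W=W_t}.$$ *Claim.* There is a universal constant $K\in\mathbb N$ such that for every $n$, every prior $\mathcal R$ over Max-Cut instances with $n$ nodes and every $\varepsilon>0$ there are rational $\beta,\rho\in(0,1)$, a rational $B>0$, a real $\lambda>0$ and some $\overline W\in\mathcal W$ such that: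 1. (complete) $\mathcal L(\overline W)\le\mathrm{opt}+\varepsilon$. 2. (compressed, with description $\mathrm{poly}(n)\,\mathrm{polylog}(1/\varepsilon)$) For every precision $\delta>0$, the numerators and denominators of $\beta,\rho,B$ written in binary, together with a code identifying any element of $\mathcal W$ up to Frobenius distance $\delta$ (a $\delta$-net of $\mathcal W$ with at most $2^k$ points, $k$ bits), take in total at most $K(n+1)^K(1+\log(1+1/\varepsilon))^K(1+\log(1+1/\delta))^K$ bits. 3. (efficiently optimizable) For every $W\in\mathbb R^{n^2\times n^2}$ the stochastic gradient at $W$ is an unbiased estimate of $\nabla\mathcal L_\lambda(W)$, and $\overline W$ minimizes $\mathcal L_\lambda$ over $\mathcal W$. There are a step size $\eta>0$ and an integer $T_0$ with $1\le T_0\le K\big((n+1)(1+1/\varepsilon)\big)^K$ such that for every starting point $W_0\in\mathcal W$ and every $T\ge T_0$, the iterates of projected SGD on $\mathcal L_\lambda$ satisfy, for $t$ uniform on $\{1,\dots,T\}$ and in expectation over $t$ and the samples, $$\mathbb E[\mathcal L_\lambda(W_t)]\le\mathcal L_\lambda(\overline W)+\varepsilon\qquad\text{and}\qquad \mathbb E[\mathcal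 L(W_t)]\le\mathcal L(\overline W)+\varepsilon .$$ -/

import Mathlib

namespace MaxCutGen

open MeasureTheory

noncomputable section

/-- Max-Cut instances on `n` nodes: weighted undirected graphs without loops, given by their
weighted adjacency matrices, with edge weights in `[0, 1]`.  Unweighted graphs are the instances
with all weights in `{0, 1}`.  The σ-algebra is the Borel one (entrywise). -/
abbrev Instance (n : ℕ) : Type :=
  {A : Fin n → Fin n → ℝ //
    (∀ i j, A i j = A j i) ∧ (∀ i, A i i = 0) ∧ ∀ i j, A i j ∈ Set.Icc (0 : ℝ) 1}

/-- Solutions: the hypercube `{±1}ⁿ`; the sign of a node is the side of the cut it is put on. -/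
abbrev Solution (n : ℕ) : Type := Fin n → ℤˣ

/-- A solution as a real `±1` vector. -/
def spin {n : ℕ} (s : Solution n) : Fin n → ℝ := fun i => ((s i : ℤ) : ℝ)

/-- The graph Laplacian `L_G = D - A`. -/
def laplacian {n : ℕ} (G : Instance n) : Matrix (Fin n) (Fin n) ℝ :=
  Matrix.diagonal (fun i => ∑ j, G.1 i j) - Matrix.of G.1

/-- The cost `L(s; G) = - sᵀ L_G s` (minus four times the weight of the cut), to be minimized. -/
def cost {n : ℕ} (s : Solution n) (G : Instance n) : ℝ :=
  -(spin s ⬝ᵥ (laplacian G).mulVec (spin s))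

/-- Flattening of an `n × n` matrix into a vector of the Euclidean space of dimension `n²`. -/
def flat {n : ℕ} (A : Matrix (Fin n) (Fin n) ℝ) : EuclideanSpace ℝ (Fin n × Fin n) :=
  WithLp.toLp 2 (fun p => A p.1 p.2)

/-- Solution features `ψ_S(s) = (s sᵀ)^♭`. -/
def solFeature {n : ℕ} (s : Solution n) : EuclideanSpace ℝ (Fin n × Fin n) :=
  flat (Matrix.vecMulVec (spin s) (spin s))

/-- Instance features `ψ_I(G) = (-L_G)^♭`. -/
def instFeature {n : ℕ} (G : Instance n) : EuclideanSpace ℝ (Fin n × Fin n) :=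
  flat (-laplacian G)

/-- Parameters: real `n² × n²` matrices with the Frobenius inner product and norm. -/
abbrev Param (n : ℕ) : Type := EuclideanSpace ℝ ((Fin n × Fin n) × (Fin n × Fin n))

/-- The score `ψ_I(G)ᵀ W ψ_S(s)`. -/
def score {n : ℕ} (W : Param n) (G : Instance n) (s : Solution n) : ℝ :=
  ∑ p, ∑ q, instFeature G p * W (p, q) * solFeature s q

/-- The exponential family `φ(s; G; W) ∝ exp(ψ_I(G)ᵀ W ψ_S(s))` over the solutions. -/
def phi {n : ℕ} (W : Param n) (G : Instance n) (s : Solution n) : ℝ :=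
  Real.exp (score W G s) / ∑ t : Solution n, Real.exp (score W G t)

/-- The fast/slow mixture generator `p(·; G; W) = (1 - β) φ(·; G; W) + β φ(·; G; ρ W)`. -/
def generator {n : ℕ} (β ρ : ℝ) (W : Param n) (G : Instance n) (s : Solution n) : ℝ :=
  (1 - β) * phi W G s + β * phi (ρ • W) G s

/-- The parameter space: matrices of Frobenius norm at most `B`. -/
def paramSpace (n : ℕ) (B : ℝ) : Set (Param n) := Metric.closedBall 0 B

/-- `opt = E_{G ∼ R} [min_s L(s; G)]`. -/
def opt {n : ℕ} (R : Measure (Instance n)) : ℝ := ∫ G, (⨅ s : Solution n, cost s G) ∂ R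

/-- The loss `L(W) = E_{G ∼ R} E_{s ∼ p(·; G; W)} [L(s; G)]`. -/
def loss {n : ℕ} (β ρ : ℝ) (R : Measure (Instance n)) (W : Param n) : ℝ :=
  ∫ G, ∑ s, generator β ρ W G s * cost s G ∂ R

/-- The negative entropy `H(W) = E_{G ∼ R} E_{s ∼ φ(·; G; W)} [log φ(s; G; W)]`. -/
def negEntropy {n : ℕ} (R : Measure (Instance n)) (W : Param n) : ℝ :=
  ∫ G, ∑ s, phi W G s * Real.log (phi W G s) ∂ R

/-- The regularizer `(1 - β) H(W) + (β / ρ) H(ρ W)`. -/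
def regularizer {n : ℕ} (β ρ : ℝ) (R : Measure (Instance n)) (W : Param n) : ℝ :=
  (1 - β) * negEntropy R W + β / ρ * negEntropy R (ρ • W)

/-- The regularized loss `L + lam * R`. -/
def regLoss {n : ℕ} (β ρ lam : ℝ) (R : Measure (Instance n)) (W : Param n) : ℝ :=
  loss β ρ R W + lam * regularizer β ρ R W

/-- Expectation of `f θ G s` when `G ∼ R`, the scale `θ` of the mixture component is `1` with
probability `1 - β` and `ρ` with probability `β`, and then `s ∼ φ(·; G; θ W)`.  Thus `s` has the
law `p(·; G; W)` given `G`. -/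
def sampleMean {n : ℕ} {E : Type*} [NormedAddCommGroup E] [NormedSpace ℝ E]
    (β ρ : ℝ) (R : Measure (Instance n)) (W : Param n)
    (f : ℝ → Instance n → Solution n → E) : E :=
  ∫ G, ((1 - β) • ∑ s, phi W G s • f 1 G s + β • ∑ s, phi (ρ • W) G s • f ρ G s) ∂ R

/-- The policy-gradient estimate of the gradient of the regularized loss at `W` from one sample
`(θ, G, s)`: `(L(s; G) + (lam / θ) log φ(s; G; θ W)) ∇_W log φ(s; G; θ W)`. -/
def stochGrad {n : ℕ} (lam : ℝ) (W : Param n) (θ : ℝ) (G : Instance n) (s : Solution n) :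
    Param n :=
  (cost s G + lam / θ * Real.log (phi (θ • W) G s)) •
    gradient (fun V : Param n => Real.log (phi (θ • V) G s)) W

/-- Euclidean projection onto `paramSpace n B`. -/
def proj {n : ℕ} (B : ℝ) (W : Param n) : Param n :=
  if ‖W‖ ≤ B then W else (B / ‖W‖) • W

/-- The transition operator of projected SGD with step size `η`: the conditional expectation of
`F(W')` given the current iterate `W`, where `W' = proj (W - η g)` and `g` is the stochastic
gradient computed from a fresh sample. -/
def sgdStep {n : ℕ} (β ρ lam B η : ℝ) (R : Measure (Instance n)) (F : Param n → ℝ) :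
    Param n → ℝ :=
  fun W => sampleMean β ρ R W (fun θ G s => F (proj B (W - η • stochGrad lam W θ G s)))

/-- `E[F(W_t)]` for the Markov chain `W₀, W₁, …` of iterates of projected SGD started at `W₀`. -/
def sgdMean {n : ℕ} (β ρ lam B η : ℝ) (R : Measure (Instance n)) (t : ℕ) (F : Param n → ℝ)
    (W₀ : Param n) : ℝ :=
  (sgdStep β ρ lam B η R)^[t] F W₀

/-- `E[F(W_τ)]` for `τ` uniform on `{1, …, T}`, independent of the iterates. -/
def sgdAverage {n : ℕ} (β ρ lam B η : ℝ) (R : Measure (Instance n)) (T : ℕ) (F : Param n → ℝ)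
    (W₀ : Param n) : ℝ :=
  (∑ t ∈ Finset.Icc 1 T, sgdMean β ρ lam B η R t F W₀) / T

/-- Number of bits of a nonnegative rational number: binary lengths of numerator and
denominator. -/
def ratBits (q : ℚ) : ℕ := Nat.size q.num.natAbs + Nat.size q.den

/-- `b` bits suffice to describe the family of generators with mixing weight `β`, temperature `ρ`
and parameter space of radius `B`, and to identify any one parameter up to Frobenius distance `δ`:
`b` covers the binary encodings of `β`, `ρ`, `B` and, for some `k`, a `k`-bit code whose at most
`2 ^ k` codewords form a `δ`-net of the parameter space. -/
def DescribedBy (n : ℕ) (β ρ B : ℚ) (δ : NNReal) (b : ℕ) : Prop :=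
  ∃ k : ℕ, Metric.coveringNumber δ (paramSpace n (B : ℝ)) ≤ ((2 ^ k : ℕ) : ℕ∞) ∧
    ratBits β + ratBits ρ + ratBits B + k ≤ b

end

end MaxCutGen

namespace MaxCutGen

open MeasureTheory

noncomputable section

/-! The score is linear in `W`, and at `target` (`-I / lam`) it equals `-cost / lam`. So at scale
`θ` the family at `target` is the Gibbs distribution of the cost at temperature `lam / θ`. The
weight `β / ρ` in the regularizer makes the regularized loss an average of free energies at
temperatures `lam` and `lam / ρ`. By Gibbs' variational principle the same parameter minimizes both,
with value at most the optimum (`regLoss_target_le`, `regLoss_target_le_opt`). As the entropy is at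
most `n`, removing the regularizer costs `O(lam * n)`, which gives completeness.

Convexity is not used for optimization; an approximate quasar-convexity around `target` replaces it
(`regLoss_sub_target_le`). Let `X` be the score of `target - W`. The gradient paired with `W -
target` is a weighted sum of the variances of `X` under the fast and slow components
(`inner_meanGrad`). The fast component may be concentrated and its variance tiny. The slow one, with
`ρ` small enough, is within a constant factor of uniform, so its variance controls the uniform
variance of `X`. Since `X` is a quadratic form on the hypercube, its uniform variance controls its
sup norm up to a constant shift (`exists_sq_quadratic_sub_le`). The free-energy gap is a scaled
relative entropy, at most `2 * lam` times that sup norm (`freeEnergy_sub_target_le`).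

Projected SGD then converges by the usual potential argument with the squared distance to `target`
(`sgdStep_sq_dist_le`, `sgdAverage_le`). The radius `B` is polynomial, so a grid on the ball gives
the short description (`coveringNumber_closedBall_le`). -/

variable {n : ℕ}

/-! ### Features and scores: bounds and continuity -/

/-- The outer product of the instance and solution features, so that the score is linear in the
parameter with coefficient vector `feat G s`. -/
def feat (G : Instance n) (s : Solution n) : Param n :=
  WithLp.toLp 2 (fun pq => instFeature G pq.1 * solFeature s pq.2)

lemma feat_apply (G : Instance n) (s : Solution n) (p q : Fin n × Fin n) :
    feat G s (p, q) = instFeature G p * solFeature s q := rfl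

lemma score_eq_inner (W : Param n) (G : Instance n) (s : Solution n) :
    score W G s = inner ℝ (feat G s) W := by
  simp only [score, PiLp.inner_apply, Fintype.sum_prod_type, feat_apply]
  simp only [RCLike.inner_apply, conj_trivial]
  refine Finset.sum_congr rfl fun _ _ => Finset.sum_congr rfl fun _ _ => ?_
  refine Finset.sum_congr rfl fun _ _ => Finset.sum_congr rfl fun _ _ => ?_
  ring

lemma score_smul (θ : ℝ) (W : Param n) (G : Instance n) (s : Solution n) :
    score (θ • W) G s = θ * score W G s := by
  simp [score_eq_inner, inner_smul_right]

lemma spin_mul_self (s : Solution n) (i : Fin n) : spin s i * spin s i = 1 := by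
  rcases Int.units_eq_one_or (s i) with h | h <;> simp [spin, h]

lemma abs_spin (s : Solution n) (i : Fin n) : |spin s i| = 1 := by
  rcases Int.units_eq_one_or (s i) with h | h <;> simp [spin, h]

lemma solFeature_apply (s : Solution n) (q : Fin n × Fin n) :
    solFeature s q = spin s q.1 * spin s q.2 := rfl

lemma instFeature_apply (G : Instance n) (q : Fin n × Fin n) :
    instFeature G q = -laplacian G q.1 q.2 := rfl

lemma cost_eq_sum (s : Solution n) (G : Instance n) :
    cost s G = ∑ p, instFeature G p * solFeature s p := by
  simp only [cost, dotProduct, Matrix.mulVec, Fintype.sum_prod_type, instFeature_apply,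
    solFeature_apply, Finset.mul_sum, ← Finset.sum_neg_distrib]
  refine Finset.sum_congr rfl fun _ _ => Finset.sum_congr rfl fun _ _ => ?_
  ring

lemma abs_instFeature_le (G : Instance n) (p : Fin n × Fin n) :
    |instFeature G p| ≤ n := by
  obtain ⟨i, j⟩ := p
  obtain ⟨A, hs, h0, hA⟩ := G
  simp only [instFeature_apply, laplacian, abs_neg, Matrix.sub_apply, Matrix.of_apply]
  have hn : (1 : ℝ) ≤ n := by exact_mod_cast i.pos
  by_cases h : i = j
  · subst h
    rw [Matrix.diagonal_apply_eq, h0, sub_zero,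
      abs_of_nonneg (Finset.sum_nonneg fun j _ => (hA i j).1)]
    calc ∑ j, A i j ≤ ∑ _j : Fin n, (1 : ℝ) := Finset.sum_le_sum fun j _ => (hA i j).2
      _ = n := by simp
  · rw [Matrix.diagonal_apply_ne _ h, zero_sub, abs_neg, abs_of_nonneg (hA i j).1]
    exact (hA i j).2.trans hn

lemma abs_solFeature (s : Solution n) (p : Fin n × Fin n) : |solFeature s p| = 1 := by
  simp [solFeature_apply, abs_mul, abs_spin]

/-- Powers of `n + 1` rather than of `n` keep all later bounds at least `1`, including at `n = 0`.
-/
lemma abs_cost_le (s : Solution n) (G : Instance n) : |cost s G| ≤ ((n : ℝ) + 1) ^ 3 := by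
  rw [cost_eq_sum]
  calc |∑ p, instFeature G p * solFeature s p| ≤ ∑ p, |instFeature G p * solFeature s p| :=
        Finset.abs_sum_le_sum_abs _ _
    _ ≤ ∑ _p : Fin n × Fin n, (n : ℝ) := by
        refine Finset.sum_le_sum fun p _ => ?_
        rw [abs_mul, abs_solFeature, mul_one]
        exact abs_instFeature_le G p
    _ = (n : ℝ) ^ 3 := by simp; ring
    _ ≤ ((n : ℝ) + 1) ^ 3 := by gcongr; linarith

lemma norm_feat_le (G : Instance n) (s : Solution n) : ‖feat G s‖ ≤ ((n : ℝ) + 1) ^ 3 := by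
  refine le_trans ?_ (show (n : ℝ) ^ 3 ≤ _ by gcongr; linarith)
  refine abs_le_of_sq_le_sq' ?_ (by positivity) |>.2
  rw [EuclideanSpace.norm_sq_eq]
  calc ∑ pq, ‖feat G s pq‖ ^ 2 ≤ ∑ _pq : (Fin n × Fin n) × (Fin n × Fin n), (n : ℝ) ^ 2 := by
        refine Finset.sum_le_sum fun pq _ => ?_
        obtain ⟨p, q⟩ := pq
        rw [feat_apply, Real.norm_eq_abs, abs_mul, abs_solFeature, mul_one]
        gcongr
        exact abs_instFeature_le G p
    _ = ((n : ℝ) ^ 3) ^ 2 := by simp; ring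

lemma abs_score_le (W : Param n) (G : Instance n) (s : Solution n) :
    |score W G s| ≤ ((n : ℝ) + 1) ^ 3 * ‖W‖ := by
  rw [score_eq_inner]
  exact (abs_real_inner_le_norm _ _).trans (by gcongr; exact norm_feat_le G s)

lemma continuous_instFeature (p : Fin n × Fin n) :
    Continuous fun G : Instance n => instFeature G p := by
  have h : ∀ i j, Continuous fun G : Instance n => G.1 i j := fun i j =>
    (continuous_apply j).comp ((continuous_apply i).comp continuous_subtype_val)
  simp only [instFeature_apply, laplacian, Matrix.sub_apply, Matrix.of_apply, Matrix.diagonal_apply]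
  split_ifs
  · exact ((continuous_finsetSum _ fun j _ => h _ j).sub (h _ _)).neg
  · exact (continuous_const.sub (h _ _)).neg

lemma continuous_feat (s : Solution n) : Continuous fun G : Instance n => feat G s := by
  refine (PiLp.continuous_toLp 2 _).comp (continuous_pi fun pq => ?_)
  exact (continuous_instFeature _).mul continuous_const

lemma continuous_cost (s : Solution n) : Continuous fun G : Instance n => cost s G := by
  simp only [cost_eq_sum]
  exact continuous_finsetSum _ fun p _ => (continuous_instFeature p).mul continuous_const

lemma continuous_score (s : Solution n) :
    Continuous fun x : Param n × Instance n => score x.1 x.2 s := by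
  simp only [score_eq_inner]
  exact ((continuous_feat s).comp continuous_snd).inner continuous_fst

/-- Compactness makes every continuous function of the instance integrable for every prior, and
supplies the uniform bounds for differentiating under the integral. -/
instance : CompactSpace (Instance n) := by
  have h : ∀ i j, Continuous fun A : Fin n → Fin n → ℝ => A i j := fun i j =>
    (continuous_apply j).comp (continuous_apply i)
  have hcl : IsClosed {A : Fin n → Fin n → ℝ |
      (∀ i j, A i j = A j i) ∧ (∀ i, A i i = 0) ∧ ∀ i j, A i j ∈ Set.Icc (0 : ℝ) 1} := by
    simp only [Set.ofPred_and, Set.ofPred_forall]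
    exact (isClosed_iInter fun i => isClosed_iInter fun j => isClosed_eq (h i j) (h j i)).inter
      ((isClosed_iInter fun i => isClosed_eq (h i i) continuous_const).inter
        (isClosed_iInter fun i => isClosed_iInter fun j => isClosed_Icc.preimage (h i j)))
  have hc : IsCompact (Set.pi Set.univ fun _ : Fin n => Set.pi Set.univ fun _ : Fin n =>
      Set.Icc (0 : ℝ) 1) := isCompact_univ_pi fun _ => isCompact_univ_pi fun _ => isCompact_Icc
  exact isCompact_iff_compactSpace.mp
    (hc.of_isClosed_subset hcl fun A hA i _ j _ => hA.2.2 i j)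

/-! ### The exponential family -/

lemma sum_exp_score_pos (W : Param n) (G : Instance n) :
    0 < ∑ t : Solution n, Real.exp (score W G t) :=
  Finset.sum_pos (fun _ _ => Real.exp_pos _) Finset.univ_nonempty

lemma phi_pos (W : Param n) (G : Instance n) (s : Solution n) : 0 < phi W G s :=
  div_pos (Real.exp_pos _) (sum_exp_score_pos W G)

lemma sum_phi (W : Param n) (G : Instance n) : ∑ s, phi W G s = 1 := by
  simp only [phi, ← Finset.sum_div]
  exact div_self (sum_exp_score_pos W G).ne'

lemma phi_le_one (W : Param n) (G : Instance n) (s : Solution n) : phi W G s ≤ 1 := by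
  rw [← sum_phi W G]
  exact Finset.single_le_sum (fun t _ => (phi_pos W G t).le) (Finset.mem_univ s)

/-- The log-partition function. -/
def logZ (W : Param n) (G : Instance n) : ℝ :=
  Real.log (∑ t : Solution n, Real.exp (score W G t))

lemma log_phi (W : Param n) (G : Instance n) (s : Solution n) :
    Real.log (phi W G s) = score W G s - logZ W G := by
  rw [phi, Real.log_div (Real.exp_pos _).ne' (sum_exp_score_pos W G).ne', Real.log_exp, logZ]

lemma log_phi_nonpos (W : Param n) (G : Instance n) (s : Solution n) :
    Real.log (phi W G s) ≤ 0 :=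
  Real.log_nonpos (phi_pos W G s).le (phi_le_one W G s)

lemma continuous_phi (s : Solution n) :
    Continuous fun x : Param n × Instance n => phi x.1 x.2 s := by
  refine Continuous.div (Real.continuous_exp.comp (continuous_score s))
    (continuous_finsetSum _ fun t _ => Real.continuous_exp.comp (continuous_score t))
    fun x => (sum_exp_score_pos x.1 x.2).ne'

lemma continuous_log_phi (s : Solution n) :
    Continuous fun x : Param n × Instance n => Real.log (phi x.1 x.2 s) :=
  (continuous_phi s).log fun x => (phi_pos x.1 x.2 s).ne'

lemma card_solution : (Fintype.card (Solution n) : ℝ) = 2 ^ n := by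
  simp

/-- Numerator and partition function each lose at most a factor `exp a` against uniform. For bounded
`a` this makes the slow component comparable to the uniform distribution. -/
lemma exp_div_le_phi {W : Param n} {G : Instance n} {a : ℝ} (h : ∀ t, |score W G t| ≤ a)
    (s : Solution n) : Real.exp (-(2 * a)) / 2 ^ n ≤ phi W G s := by
  have h1 : ∑ t : Solution n, Real.exp (score W G t) ≤ 2 ^ n * Real.exp a := by
    rw [← card_solution, ← nsmul_eq_mul]
    exact Finset.sum_le_card_nsmul _ _ _ fun t _ => Real.exp_le_exp.2 (abs_le.1 (h t)).2
  rw [phi, div_le_div_iff₀ (by positivity) (sum_exp_score_pos W G)]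
  calc _ ≤ Real.exp (-(2 * a)) * (2 ^ n * Real.exp a) := by gcongr
    _ = Real.exp (-a) * 2 ^ n := by
        rw [show -(2 * a) = -a + -a by ring, Real.exp_add, Real.exp_neg a]
        field_simp
    _ ≤ _ := by gcongr; exact (abs_le.1 (h s)).1

lemma abs_log_phi_le {W : Param n} {G : Instance n} {a : ℝ} (h : ∀ t, |score W G t| ≤ a)
    (s : Solution n) : |Real.log (phi W G s)| ≤ n + 2 * a := by
  rw [abs_of_nonpos (log_phi_nonpos W G s)]
  have h1 := Real.log_le_log (by positivity) (exp_div_le_phi h s)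
  rw [Real.log_div (Real.exp_pos _).ne' (by positivity), Real.log_exp, Real.log_pow] at h1
  have h2 : (n : ℝ) * Real.log 2 ≤ n * 1 := by
    gcongr
    linarith [Real.log_two_lt_d9]
  linarith

/-! ### Gradient of the log-likelihood -/

/-- The mean of the features under the exponential family. -/
def meanFeat (W : Param n) (G : Instance n) : Param n := ∑ t, phi W G t • feat G t

lemma norm_meanFeat_le (W : Param n) (G : Instance n) :
    ‖meanFeat W G‖ ≤ ((n : ℝ) + 1) ^ 3 := by
  calc ‖meanFeat W G‖ ≤ ∑ t, ‖phi W G t • feat G t‖ := norm_sum_le _ _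
    _ ≤ ∑ t, phi W G t * ((n : ℝ) + 1) ^ 3 := by
        refine Finset.sum_le_sum fun t _ => ?_
        rw [norm_smul, Real.norm_of_nonneg (phi_pos W G t).le]
        exact mul_le_mul_of_nonneg_left (norm_feat_le G t) (phi_pos W G t).le
    _ = ((n : ℝ) + 1) ^ 3 := by rw [← Finset.sum_mul, sum_phi, one_mul]

lemma continuous_meanFeat : Continuous fun x : Param n × Instance n => meanFeat x.1 x.2 :=
  continuous_finsetSum _ fun t _ =>
    (continuous_phi t).smul ((continuous_feat t).comp continuous_snd)

lemma hasGradientAt_score_smul (θ : ℝ) (G : Instance n) (s : Solution n) (W : Param n) :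
    HasGradientAt (fun V => score (θ • V) G s) (θ • feat G s) W := by
  rw [hasGradientAt_iff_hasFDerivAt]
  have h : (fun V => score (θ • V) G s)
      = fun V => InnerProductSpace.toDual ℝ (Param n) (θ • feat G s) V := by
    funext V
    rw [InnerProductSpace.toDual_apply_apply, inner_smul_left, score_smul, score_eq_inner]
    rfl
  rw [h]
  exact ContinuousLinearMap.hasFDerivAt _

/-- The gradient of the log-partition function is the mean feature, so the log-likelihood has the
centered feature as gradient. -/
lemma hasGradientAt_log_phi (θ : ℝ) (G : Instance n) (s : Solution n) (W : Param n) :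
    HasGradientAt (fun V => Real.log (phi (θ • V) G s))
      (θ • (feat G s - meanFeat (θ • W) G)) W := by
  simp only [log_phi, logZ]
  have hs := fun t => (hasGradientAt_score_smul θ G t W).hasFDerivAt
  have h := (hs s).sub ((HasFDerivAt.fun_sum (u := Finset.univ) fun t _ => (hs t).exp).log
    (sum_exp_score_pos (θ • W) G).ne')
  rw [hasGradientAt_iff_hasFDerivAt]
  refine h.congr_fderiv ?_
  simp only [smul_sub, map_sub, meanFeat, map_smul, map_sum, Finset.smul_sum]
  congr 1
  refine Finset.sum_congr rfl fun t _ => ?_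
  rw [phi, smul_smul, smul_comm, smul_smul, smul_smul]
  congr 1
  ring

lemma stochGrad_eq (lam : ℝ) (W : Param n) (θ : ℝ) (G : Instance n) (s : Solution n) :
    stochGrad lam W θ G s = (cost s G + lam / θ * Real.log (phi (θ • W) G s)) •
      (θ • (feat G s - meanFeat (θ • W) G)) := by
  rw [stochGrad, (hasGradientAt_log_phi θ G s W).gradient]

lemma continuous_stochGrad (lam θ : ℝ) (s : Solution n) :
    Continuous fun x : Param n × Instance n => stochGrad lam x.1 θ x.2 s := by
  simp only [stochGrad_eq]
  have h : Continuous fun x : Param n × Instance n => (θ • x.1, x.2) :=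
    (continuous_fst.const_smul θ).prodMk continuous_snd
  exact (((continuous_cost s).comp continuous_snd).add
    (continuous_const.mul ((continuous_log_phi s).comp h))).smul
    ((((continuous_feat s).comp continuous_snd).sub (continuous_meanFeat.comp h)).const_smul θ)

/-! ### Quadratic forms on the hypercube -/

lemma spin_flip (s : Solution n) (a i : Fin n) :
    spin (s * Pi.mulSingle a (-1)) i = if i = a then -spin s i else spin s i := by
  by_cases h : i = a
  · subst h; simp [spin]
  · simp [spin, h]

lemma sum_eq_zero_of_flip (a : Fin n) (f : Solution n → ℝ)
    (h : ∀ s, f (s * Pi.mulSingle a (-1)) = -f s) : ∑ s, f s = 0 := by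
  have h1 := Equiv.sum_comp (Equiv.mulRight (Pi.mulSingle a (-1) : Solution n)) f
  simp only [Equiv.coe_mulRight, h, Finset.sum_neg_distrib] at h1
  linarith

lemma sum_solFeature {q : Fin n × Fin n} (hq : q.1 < q.2) :
    ∑ s : Solution n, solFeature s q = 0 := by
  refine sum_eq_zero_of_flip q.1 _ fun s => ?_
  simp [solFeature_apply, spin_flip, hq.ne']

/-- Products of two distinct spins are orthogonal characters: of two different ordered pairs, one
has a node missing from the other, and flipping it changes the sign of the product. -/
lemma sum_solFeature_mul {q r : Fin n × Fin n} (hq : q.1 < q.2) (hr : r.1 < r.2) :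
    ∑ s : Solution n, solFeature s q * solFeature s r = if q = r then 2 ^ n else 0 := by
  split_ifs with h
  · subst h
    rw [← card_solution, ← nsmul_one, ← Finset.card_univ, ← Finset.sum_const]
    refine Finset.sum_congr rfl fun s _ => ?_
    rw [← abs_mul_abs_self, abs_solFeature, mul_one]
  · by_cases h1 : q.1 = r.1 ∨ q.1 = r.2
    · refine sum_eq_zero_of_flip q.2 _ fun s => ?_
      -- When `q.1` already lies in `r`, the ordering of both pairs and `q ≠ r` exclude `q.2` from
      -- `r`.
      have h2 : r.1 ≠ q.2 ∧ r.2 ≠ q.2 := by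
        constructor
        · intro h3
          rcases h1 with h1 | h1 <;> omega
        · intro h3
          rcases h1 with h1 | h1
          · exact h (Prod.ext h1 h3.symm)
          · omega
      simp [solFeature_apply, spin_flip, h2.1, h2.2, hq.ne]
    · refine sum_eq_zero_of_flip q.1 _ fun s => ?_
      push Not at h1
      simp [solFeature_apply, spin_flip, h1.1.symm, h1.2.symm, hq.ne']

lemma sum_prod_eq_diag_add_lt (f : Fin n × Fin n → ℝ) :
    ∑ q, f q = ∑ i, f (i, i) + ∑ q : Fin n × Fin n with q.1 < q.2, (f q + f q.swap) := by
  have h1 : ∑ q : Fin n × Fin n with q.1 < q.2, f q.swap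
      = ∑ q : Fin n × Fin n with q.2 < q.1, f q := by
    refine Finset.sum_nbij' Prod.swap Prod.swap ?_ ?_ ?_ ?_ ?_ <;> simp
  have h2 : ∑ i, f (i, i) = ∑ q : Fin n × Fin n with q.1 = q.2, f q := by
    refine Finset.sum_nbij' (fun i => (i, i)) Prod.fst ?_ ?_ ?_ ?_ ?_ <;> simp
  rw [Finset.sum_add_distrib, h1, h2]
  simp only [Finset.sum_filter, ← Finset.sum_add_distrib]
  refine Finset.sum_congr rfl fun q _ => ?_
  rcases lt_trichotomy q.1 q.2 with h | h | h
  · simp [h, h.ne, h.not_gt]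
  · simp [h]
  · simp [h, h.ne', h.not_gt]

/-- On the hypercube, the sup norm of a centered quadratic form is controlled by its standard
deviation under the uniform distribution. -/
lemma exists_sq_quadratic_sub_le (a : Fin n × Fin n → ℝ) :
    ∃ c₀ : ℝ, ∀ (c : ℝ) (s : Solution n), (∑ q, a q * solFeature s q - c₀) ^ 2 ≤
      (n : ℝ) ^ 2 * ((∑ t : Solution n, (∑ q, a q * solFeature t q - c) ^ 2) / 2 ^ n) := by
  set P : Finset (Fin n × Fin n) := Finset.univ.filter fun q => q.1 < q.2 with hP
  set d : Fin n × Fin n → ℝ := fun q => a q + a q.swap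
  have hX : ∀ s : Solution n, ∑ q, a q * solFeature s q
      = ∑ i, a (i, i) + ∑ q ∈ P, d q * solFeature s q := by
    intro s
    rw [sum_prod_eq_diag_add_lt]
    congr 1
    · refine Finset.sum_congr rfl fun i _ => ?_
      rw [solFeature_apply, spin_mul_self, mul_one]
    · refine Finset.sum_congr rfl fun q _ => ?_
      simp only [solFeature_apply, Prod.fst_swap, Prod.snd_swap, d]
      ring
  have hP' : ∀ q ∈ P, q.1 < q.2 := fun q hq => (Finset.mem_filter.1 hq).2
  have h1 : ∑ t : Solution n, ∑ q ∈ P, d q * solFeature t q = 0 := by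
    rw [Finset.sum_comm]
    refine Finset.sum_eq_zero fun q hq => ?_
    rw [← Finset.mul_sum, sum_solFeature (hP' q hq), mul_zero]
  have h2 : ∑ t : Solution n, (∑ q ∈ P, d q * solFeature t q) ^ 2
      = 2 ^ n * ∑ q ∈ P, d q ^ 2 := by
    simp only [sq, Finset.sum_mul_sum]
    rw [Finset.sum_comm, Finset.mul_sum]
    refine Finset.sum_congr rfl fun q hq => ?_
    rw [Finset.sum_comm]
    calc ∑ r ∈ P, ∑ t : Solution n, d q * solFeature t q * (d r * solFeature t r)
        = ∑ r ∈ P, d q * d r * if q = r then 2 ^ n else 0 := by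
          refine Finset.sum_congr rfl fun r hr => ?_
          rw [← sum_solFeature_mul (hP' q hq) (hP' r hr), Finset.mul_sum]
          exact Finset.sum_congr rfl fun t _ => by ring
      _ = _ := by simp [hq, mul_comm]
  -- Squared spins are `1`, so the trace is the uniform mean of the form. Any other center `c` only
  -- increases the second moment; `c` is kept free because the slow component has a different mean.
  refine ⟨∑ i, a (i, i), fun c s => ?_⟩
  have h3 : ∑ t : Solution n, (∑ q, a q * solFeature t q - c) ^ 2
      = 2 ^ n * (∑ i, a (i, i) - c) ^ 2 + 2 ^ n * ∑ q ∈ P, d q ^ 2 := by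
    rw [← h2]
    have : ∀ t : Solution n, (∑ q, a q * solFeature t q - c) ^ 2 = (∑ i, a (i, i) - c) ^ 2
        + 2 * (∑ i, a (i, i) - c) * ∑ q ∈ P, d q * solFeature t q
        + (∑ q ∈ P, d q * solFeature t q) ^ 2 := fun t => by rw [hX]; ring
    simp only [this, Finset.sum_add_distrib, ← Finset.mul_sum, h1, Finset.sum_const,
      Finset.card_univ, nsmul_eq_mul, card_solution, mul_zero, add_zero]
  rw [h3, hX, add_sub_cancel_left, ← mul_add, mul_div_cancel_left₀ _ (by positivity)]
  calc (∑ q ∈ P, d q * solFeature s q) ^ 2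
      ≤ (∑ q ∈ P, d q ^ 2) * ∑ q ∈ P, solFeature s q ^ 2 :=
        Finset.sum_mul_sq_le_sq_mul_sq _ _ _
    _ = (∑ q ∈ P, d q ^ 2) * P.card := by
        simp only [← sq_abs (solFeature s _), abs_solFeature]
        simp
    _ ≤ (∑ q ∈ P, d q ^ 2) * (n : ℝ) ^ 2 := by
        have : P.card ≤ n ^ 2 := (Finset.card_le_univ P).trans (by simp [sq])
        gcongr
        exact_mod_cast this
    _ ≤ _ := by
        rw [mul_comm]
        gcongr
        nlinarith [sq_nonneg (∑ i, a (i, i) - c)]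

lemma score_eq_quadratic (V : Param n) (G : Instance n) (s : Solution n) :
    score V G s = ∑ q, (∑ p, instFeature G p * V (p, q)) * solFeature s q := by
  simp only [score, Finset.sum_mul]
  exact Finset.sum_comm

lemma score_sub (V W : Param n) (G : Instance n) (s : Solution n) :
    score (V - W) G s = score V G s - score W G s := by
  simp [score_eq_inner, inner_sub_right]

/-! ### Free energies and Gibbs' variational principle -/

/-- The free energy `E[L] + (lam / θ) E[log φ]` of the exponential family at parameter `θ W`. -/
def freeEnergy (lam θ : ℝ) (W : Param n) (G : Instance n) : ℝ :=
  ∑ s, phi (θ • W) G s * (cost s G + lam / θ * Real.log (phi (θ • W) G s))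

/-- The parameter `-I / lam`, at which the exponential family is the Gibbs distribution of the
cost at temperature `lam`. -/
def target (n : ℕ) (lam : ℝ) : Param n :=
  WithLp.toLp 2 (fun pq => if pq.1 = pq.2 then -(1 / lam) else 0)

lemma score_target (lam : ℝ) (G : Instance n) (s : Solution n) :
    score (target n lam) G s = -(1 / lam) * cost s G := by
  simp only [score, target, cost_eq_sum, Finset.mul_sum]
  refine Finset.sum_congr rfl fun p _ => ?_
  simp only [mul_ite, mul_zero, ite_mul, zero_mul, Finset.sum_ite_eq, Finset.mem_univ, if_true]
  ring

lemma norm_target {lam : ℝ} (hl : 0 < lam) : ‖target n lam‖ = n / lam := by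
  rw [← sq_eq_sq₀ (norm_nonneg _) (by positivity), EuclideanSpace.norm_sq_eq, Fintype.sum_prod_type]
  simp only [target, Real.norm_eq_abs, sq_abs, ite_pow]
  simp only [ne_eq, OfNat.ofNat_ne_zero, not_false_eq_true, zero_pow, Finset.sum_ite_eq,
    Finset.mem_univ, if_true, Finset.sum_const, Finset.card_univ, Fintype.card_prod,
    Fintype.card_fin, nsmul_eq_mul]
  push_cast
  field_simp

/-- Since the cost is `-lam` times the target score, the weight in the policy gradient is `-lam * X`
plus a term independent of `s`. -/
lemma cost_add_eq {lam θ : ℝ} (hl : 0 < lam) (hθ : 0 < θ) (W : Param n) (G : Instance n)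
    (s : Solution n) :
    cost s G + lam / θ * Real.log (phi (θ • W) G s)
      = -lam * score (target n lam - W) G s - lam / θ * logZ (θ • W) G := by
  rw [log_phi, score_smul, score_sub, score_target]
  field_simp
  ring

lemma freeEnergy_target {lam θ : ℝ} (hl : 0 < lam) (hθ : 0 < θ) (G : Instance n) :
    freeEnergy lam θ (target n lam) G = -(lam / θ * logZ (θ • target n lam) G) := by
  simp only [freeEnergy, cost_add_eq hl hθ, sub_self]
  simp only [score_eq_inner, inner_zero_right, mul_zero, zero_sub, ← Finset.sum_mul, sum_phi,
    one_mul]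

/-- This is `log φ ≤ 0` at the target, multiplied by `lam / θ`. -/
lemma freeEnergy_target_le_cost {lam θ : ℝ} (hl : 0 < lam) (hθ : 0 < θ) (G : Instance n)
    (s : Solution n) : freeEnergy lam θ (target n lam) G ≤ cost s G := by
  have h := log_phi_nonpos (θ • target n lam) G s
  rw [log_phi, score_smul, score_target] at h
  rw [freeEnergy_target hl hθ]
  have h2 := mul_le_mul_of_nonneg_left h (div_pos hl hθ).le
  rw [mul_zero, mul_sub] at h2
  have h3 : lam / θ * (θ * (-(1 / lam) * cost s G)) = -cost s G := by field_simp
  linarith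

/-- Gibbs' inequality, from `log x ≤ x - 1` at `x = q / p`. -/
lemma sum_mul_log_sub_log_nonneg {S : Type*} [Fintype S] {p q : S → ℝ} (hp : ∀ s, 0 < p s)
    (hq : ∀ s, 0 < q s) (hpq : ∑ s, p s = ∑ s, q s) :
    0 ≤ ∑ s, p s * (Real.log (p s) - Real.log (q s)) := by
  have h : ∑ s, (p s - q s) ≤ ∑ s, p s * (Real.log (p s) - Real.log (q s)) := by
    refine Finset.sum_le_sum fun s _ => ?_
    have h1 := Real.log_le_sub_one_of_pos (div_pos (hq s) (hp s))
    rw [Real.log_div (hq s).ne' (hp s).ne'] at h1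
    have h2 := mul_le_mul_of_nonneg_left h1 (hp s).le
    have h3 : p s * (q s / p s - 1) = q s - p s := by
      have := (hp s).ne'
      field_simp
    linarith
  rwa [Finset.sum_sub_distrib, hpq, sub_self] at h

lemma freeEnergy_sub_target {lam θ : ℝ} (hl : 0 < lam) (hθ : 0 < θ) (W : Param n)
    (G : Instance n) : freeEnergy lam θ W G - freeEnergy lam θ (target n lam) G
      = lam / θ * ∑ s, phi (θ • W) G s *
        (Real.log (phi (θ • W) G s) - Real.log (phi (θ • target n lam) G s)) := by
  have h : ∀ s, phi (θ • W) G s * (cost s G + lam / θ * Real.log (phi (θ • W) G s))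
      = lam / θ * (phi (θ • W) G s *
          (Real.log (phi (θ • W) G s) - Real.log (phi (θ • target n lam) G s)))
        - phi (θ • W) G s * (lam / θ * logZ (θ • target n lam) G) := by
    intro s
    rw [log_phi _ _ s, log_phi _ _ s, score_smul, score_smul, score_target]
    field_simp
    ring
  rw [freeEnergy_target hl hθ]
  simp only [freeEnergy, h, Finset.sum_sub_distrib, ← Finset.sum_mul, sum_phi, ← Finset.mul_sum]
  ring

lemma freeEnergy_target_le {lam θ : ℝ} (hl : 0 < lam) (hθ : 0 < θ) (W : Param n)
    (G : Instance n) : freeEnergy lam θ (target n lam) G ≤ freeEnergy lam θ W G := by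
  rw [← sub_nonneg, freeEnergy_sub_target hl hθ]
  refine mul_nonneg (div_pos hl hθ).le ?_
  exact sum_mul_log_sub_log_nonneg (phi_pos _ _) (phi_pos _ _) (by rw [sum_phi, sum_phi])

/-- The relative entropy is at most its symmetrization, in which the normalizers and the shift `c₀`
cancel and a factor `θ` appears that absorbs the `1 / θ`. The remaining sum is at most twice the sup
norm of the shifted score. The parameter `τ` linearizes `2 * √b` into `τ + b / τ`, so that a
variance can be substituted for `b`. -/
lemma freeEnergy_sub_target_le {lam θ τ b c₀ : ℝ} (hl : 0 < lam) (hθ : 0 < θ) (hτ : 0 < τ)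
    (W : Param n) (G : Instance n) (hb : ∀ s, (score (target n lam - W) G s - c₀) ^ 2 ≤ b) :
    freeEnergy lam θ W G - freeEnergy lam θ (target n lam) G ≤ lam * (τ + b / τ) := by
  rw [freeEnergy_sub_target hl hθ]
  have hp := phi_pos (θ • W) G
  have hq := phi_pos (θ • target n lam) G
  have hp1 := sum_phi (θ • W) G
  have hq1 := sum_phi (θ • target n lam) G
  have hl1 : ∀ s, Real.log (phi (θ • W) G s) - Real.log (phi (θ • target n lam) G s)
      = -θ * (score (target n lam - W) G s - c₀)
        + (-θ * c₀ + logZ (θ • target n lam) G - logZ (θ • W) G) := by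
    intro s
    rw [log_phi, log_phi, score_smul, score_smul, score_sub]
    ring
  have h0 := sum_mul_log_sub_log_nonneg hq hp (by rw [hp1, hq1])
  generalize phi (θ • W) G = p at *
  generalize phi (θ • target n lam) G = q at *
  generalize (-θ * c₀ + logZ (θ • target n lam) G - logZ (θ • W) G) = k at *
  set y := fun s => score (target n lam - W) G s - c₀
  have h1 : ∑ s, p s * (Real.log (p s) - Real.log (q s)) ≤
      ∑ s, (p s - q s) * (Real.log (p s) - Real.log (q s)) := by
    simp only [sub_mul, Finset.sum_sub_distrib]
    have : ∑ s, q s * (Real.log (q s) - Real.log (p s))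
      = -∑ s, q s * (Real.log (p s) - Real.log (q s)) := by
      rw [← Finset.sum_neg_distrib]
      exact Finset.sum_congr rfl fun s _ => by ring
    simp only [mul_sub, Finset.sum_sub_distrib] at *
    linarith
  have h2 : ∑ s, (p s - q s) * (Real.log (p s) - Real.log (q s))
      = θ * ∑ s, (q s - p s) * y s := by
    have h3 : ∀ s, (p s - q s) * (Real.log (p s) - Real.log (q s))
        = θ * ((q s - p s) * y s) + (p s - q s) * k := fun s => by rw [hl1]; ring
    simp only [h3, Finset.sum_add_distrib, ← Finset.sum_mul, Finset.sum_sub_distrib, hp1, hq1,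
      ← Finset.mul_sum, sub_self, zero_mul, add_zero]
  have h3 : ∑ s, (q s - p s) * y s ≤ τ + b / τ := by
    calc ∑ s, (q s - p s) * y s ≤ ∑ s, (q s + p s) * ((τ + b / τ) / 2) := by
          refine Finset.sum_le_sum fun s _ => ?_
          have h4 : |y s| ≤ (τ + b / τ) / 2 := by
            have h5 : y s ^ 2 / τ ≤ b / τ := by gcongr; exact hb s
            have h6 : 2 * |y s| ≤ τ + y s ^ 2 / τ := by
              rw [← sq_abs, ← sub_nonneg]
              have : τ + |y s| ^ 2 / τ - 2 * |y s| = (τ - |y s|) ^ 2 / τ := by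
                field_simp
                ring
              rw [this]
              positivity
            linarith
          have h7 := abs_le.1 h4
          nlinarith [hp s, hq s, mul_nonneg (hq s).le (sub_nonneg.2 h7.2),
            mul_nonneg (hp s).le (show 0 ≤ y s + (τ + b / τ) / 2 by linarith)]
      _ = τ + b / τ := by
          rw [← Finset.sum_mul, Finset.sum_add_distrib, hp1, hq1]
          ring
  calc lam / θ * ∑ s, p s * (Real.log (p s) - Real.log (q s))
      ≤ lam / θ * (θ * (τ + b / τ)) := by
        refine mul_le_mul_of_nonneg_left (h1.trans ?_) (div_pos hl hθ).le
        rw [h2]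
        exact mul_le_mul_of_nonneg_left h3 hθ.le
    _ = lam * (τ + b / τ) := by field_simp

/-! ### Quasar-convexity for a single instance -/

/-- The gradient of the free energy, as the mean of the stochastic gradient. -/
def meanGrad (lam θ : ℝ) (W : Param n) (G : Instance n) : Param n :=
  ∑ s, phi (θ • W) G s • stochGrad lam W θ G s

/-- Paired with `W - target`, the centered feature becomes `-(X - c)`, where `c` is the mean of `X`.
The weight is `-lam * X` up to a constant, which the centering kills. What is left is the covariance
of `X` with itself. -/
lemma inner_meanGrad {lam θ : ℝ} (hl : 0 < lam) (hθ : 0 < θ) (W : Param n) (G : Instance n) :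
    ∃ c : ℝ, inner ℝ (meanGrad lam θ W G) (W - target n lam)
      = θ * lam * ∑ s, phi (θ • W) G s * (score (target n lam - W) G s - c) ^ 2 := by
  have hp1 := sum_phi (θ • W) G
  set X := score (target n lam - W) G with hX
  set c := ∑ s, phi (θ • W) G s * X s with hc
  refine ⟨c, ?_⟩
  have hF : ∀ s, inner ℝ (feat G s) (W - target n lam) = -X s := by
    intro s
    rw [hX, score_eq_inner, ← neg_sub, inner_neg_right]
  have hm : inner ℝ (meanFeat (θ • W) G) (W - target n lam) = -c := by
    simp only [meanFeat, sum_inner, inner_smul_left, conj_trivial, hF, mul_neg,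
      Finset.sum_neg_distrib, hc]
  simp only [meanGrad, stochGrad_eq, sum_inner, inner_smul_left, inner_sub_left, conj_trivial, hF,
    hm, cost_add_eq hl hθ]
  rw [← hX]
  generalize phi (θ • W) G = p at *
  generalize lam / θ * logZ (θ • W) G = k
  have h1 : ∑ s, p s * (X s - c) = 0 := by
    simp only [mul_sub, Finset.sum_sub_distrib, ← Finset.sum_mul, hp1, one_mul, hc, sub_self]
  have h2 : ∀ s, p s * ((-lam * X s - k) * (θ * (-X s - -c)))
      = θ * lam * (p s * (X s - c) ^ 2) + θ * (lam * c + k) * (p s * (X s - c)) := by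
    intro s
    ring
  simp only [h2, Finset.sum_add_distrib, ← Finset.mul_sum, h1, mul_zero, add_zero]

lemma mixture_freeEnergy_sub_le {lam β ρ τ : ℝ} (hl : 0 < lam) (hβ : 0 < β) (hβ1 : β < 1)
    (hρ : 0 < ρ) (hτ : 0 < τ) (W : Param n) (G : Instance n)
    (hW : ρ * (((n : ℝ) + 1) ^ 3 * ‖W‖) ≤ 1) :
    (1 - β) * freeEnergy lam 1 W G + β * freeEnergy lam ρ W G
      - ((1 - β) * freeEnergy lam 1 (target n lam) G + β * freeEnergy lam ρ (target n lam) G)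
      ≤ lam * τ + 8 * (n : ℝ) ^ 2 / (τ * β * ρ) *
        inner ℝ ((1 - β) • meanGrad lam 1 W G + β • meanGrad lam ρ W G) (W - target n lam) := by
  obtain ⟨c1, h1⟩ := inner_meanGrad hl one_pos W G
  obtain ⟨c2, h2⟩ := inner_meanGrad hl hρ W G
  obtain ⟨c₀, hc₀⟩ := exists_sq_quadratic_sub_le
    (fun q => ∑ p, instFeature G p * (target n lam - W) (p, q))
  simp only [← score_eq_quadratic] at hc₀
  set X := score (target n lam - W) G
  set v := ∑ s, phi (ρ • W) G s * (X s - c2) ^ 2 with hv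
  have hE : Real.exp 2 ≤ 8 := by
    have := Real.exp_one_lt_d9
    rw [show (2 : ℝ) = 1 + 1 by norm_num, Real.exp_add]
    nlinarith [Real.exp_pos 1]
  -- By `hW` the slow scores are at most `1` in absolute value, so uniform weights are at most `exp
  -- 2 ≤ 8` times the slow ones. The slow variance thus bounds both gaps; the fast variance is only
  -- used as nonnegative.
  have hb : ∀ s, (X s - c₀) ^ 2 ≤ 8 * (n : ℝ) ^ 2 * v := by
    intro s
    refine (hc₀ c2 s).trans ?_
    rw [mul_comm 8, mul_assoc]
    refine mul_le_mul_of_nonneg_left ?_ (by positivity)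
    rw [Finset.sum_div, hv, Finset.mul_sum]
    refine Finset.sum_le_sum fun t _ => ?_
    have h3 := exp_div_le_phi (W := ρ • W) (G := G) (a := 1) (fun u => by
      rw [score_smul, abs_mul, abs_of_pos hρ]
      exact (mul_le_mul_of_nonneg_left (abs_score_le W G u) hρ.le).trans hW) t
    have h4 : 1 / 2 ^ n ≤ 8 * phi (ρ • W) G t := by
      calc (1 : ℝ) / 2 ^ n = Real.exp 2 * (Real.exp (-(2 * 1)) / 2 ^ n) := by
            rw [mul_one, Real.exp_neg]
            field_simp
        _ ≤ 8 * phi (ρ • W) G t := by gcongr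
    calc (X t - c2) ^ 2 / 2 ^ n = 1 / 2 ^ n * (X t - c2) ^ 2 := by ring
      _ ≤ 8 * phi (ρ • W) G t * (X t - c2) ^ 2 := by gcongr
      _ = _ := by ring
  have g1 := freeEnergy_sub_target_le hl one_pos hτ W G hb
  have g2 := freeEnergy_sub_target_le hl hρ hτ W G hb
  have hv1 : 0 ≤ ∑ s, phi ((1 : ℝ) • W) G s * (X s - c1) ^ 2 :=
    Finset.sum_nonneg fun s _ => mul_nonneg (phi_pos _ _ _).le (sq_nonneg _)
  rw [inner_add_left, inner_smul_left, inner_smul_left, h1, h2, conj_trivial, conj_trivial]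
  have h5 : lam * (8 * (n : ℝ) ^ 2 * v / τ)
      = 8 * (n : ℝ) ^ 2 / (τ * β * ρ) * (β * (ρ * lam * v)) := by field_simp
  have h6 : 0 ≤ 8 * (n : ℝ) ^ 2 / (τ * β * ρ) *
      ((1 - β) * (1 * lam * ∑ s, phi ((1 : ℝ) • W) G s * (X s - c1) ^ 2)) := by
    have : 0 < 1 - β := by linarith
    positivity
  rw [mul_add] at g1 g2
  have g3 := mul_le_mul_of_nonneg_left g1 (show 0 ≤ 1 - β by linarith)
  have g4 := mul_le_mul_of_nonneg_left g2 hβ.le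
  rw [mul_add (8 * (n : ℝ) ^ 2 / (τ * β * ρ))]
  rw [← h5]
  linarith

/-! ### Averaging over the prior -/

lemma integrable_of_continuous_instance {E : Type*} [NormedAddCommGroup E]
    [SecondCountableTopology E] (R : Measure (Instance n)) [IsProbabilityMeasure R]
    {f : Instance n → E} (hf : Continuous f) : Integrable f R :=
  hf.integrable_of_hasCompactSupport (HasCompactSupport.of_compactSpace f)

lemma continuous_integral_instance (R : Measure (Instance n)) [IsProbabilityMeasure R]
    {f : Param n → Instance n → ℝ} (hf : Continuous fun x : Param n × Instance n => f x.1 x.2) :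
    Continuous fun W => ∫ G, f W G ∂ R := by
  have h := continuous_parametric_integral_of_continuous (μ := R) (f := f) hf
    (isCompact_univ (X := Instance n))
  simpa only [Measure.restrict_univ] using h

lemma hasGradientAt_integral (R : Measure (Instance n)) [IsProbabilityMeasure R]
    {f : Param n → Instance n → ℝ} {g : Param n → Instance n → Param n}
    (hf : ∀ W, Continuous (f W)) (hg : Continuous fun x : Param n × Instance n => g x.1 x.2)
    (h : ∀ W G, HasGradientAt (fun V => f V G) (g W G) W) (W : Param n) :
    HasGradientAt (fun V => ∫ G, f V G ∂ R) (∫ G, g W G ∂ R) W := by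
  have hgW : ∀ W, Continuous (g W) := fun W => hg.comp (Continuous.prodMk_right W)
  have hd : ∀ W, Continuous fun G => InnerProductSpace.toDual ℝ (Param n) (g W G) := fun W =>
    (InnerProductSpace.toDual ℝ (Param n)).continuous.comp (hgW W)
  obtain ⟨C, hC⟩ := ((isCompact_closedBall W 1).prod
    (isCompact_univ (X := Instance n))).exists_bound_of_continuousOn hg.continuousOn
  have key := hasFDerivAt_integral_of_dominated_of_fderiv_le (μ := R) (𝕜 := ℝ) (F := f)
    (F' := fun V G => InnerProductSpace.toDual ℝ (Param n) (g V G)) (x₀ := W)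
    (bound := fun _ => C) (Metric.closedBall_mem_nhds W one_pos)
    (Filter.Eventually.of_forall fun V => (hf V).aestronglyMeasurable)
    (integrable_of_continuous_instance R (hf W)) (hd W).aestronglyMeasurable
    (Filter.Eventually.of_forall fun G V hV => by
      rw [LinearIsometryEquiv.norm_map]
      exact hC (V, G) ⟨hV, Set.mem_univ _⟩)
    (integrable_const C)
    (Filter.Eventually.of_forall fun G V _ => (h V G).hasFDerivAt)
  rw [hasGradientAt_iff_hasFDerivAt]
  refine key.congr_fderiv ?_
  ext1 v
  rw [ContinuousLinearMap.integral_apply (integrable_of_continuous_instance R (hd W))]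
  simp only [InnerProductSpace.toDual_apply_apply]
  rw [real_inner_comm, ← integral_inner (integrable_of_continuous_instance R (hgW W))]
  exact integral_congr_ae (Filter.Eventually.of_forall fun G => real_inner_comm _ _)

lemma toDual_smul (c : ℝ) (v : Param n) : InnerProductSpace.toDual ℝ (Param n) (c • v)
    = c • InnerProductSpace.toDual ℝ (Param n) v := by
  rw [map_smulₛₗ]
  rfl

lemma sum_phi_smul_centered (θ : ℝ) (W : Param n) (G : Instance n) :
    ∑ s, phi W G s • (θ • (feat G s - meanFeat W G)) = 0 := by
  simp only [smul_comm _ θ, ← Finset.smul_sum, smul_sub, Finset.sum_sub_distrib,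
    ← Finset.sum_smul, sum_phi, one_smul, meanFeat, sub_self]

/-- In the product rule, the term from differentiating `log φ` inside the bracket is a multiple of
the mean centered feature, which vanishes. The other term is the policy gradient. -/
lemma hasGradientAt_freeEnergy (lam θ : ℝ) (W : Param n) (G : Instance n) :
    HasGradientAt (fun V => freeEnergy lam θ V G) (meanGrad lam θ W G) W := by
  have hl := fun s => (hasGradientAt_log_phi θ G s W).hasFDerivAt
  have hp : ∀ s, HasFDerivAt (fun V : Param n => phi (θ • V) G s)
      (phi (θ • W) G s • InnerProductSpace.toDual ℝ (Param n)
        (θ • (feat G s - meanFeat (θ • W) G))) W := by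
    intro s
    have h := (hl s).exp
    simpa only [Real.exp_log (phi_pos _ _ _)] using h
  have h := HasFDerivAt.fun_sum (u := Finset.univ) fun s _ =>
    (hp s).mul (((hl s).const_mul (lam / θ)).const_add (cost s G))
  rw [hasGradientAt_iff_hasFDerivAt]
  refine h.congr_fderiv ?_
  have h0 := congrArg (fun v => (lam / θ) • InnerProductSpace.toDual ℝ (Param n) v)
    (sum_phi_smul_centered θ (θ • W) G)
  simp only [map_sum, map_zero, smul_zero, Finset.smul_sum] at h0
  rw [Finset.sum_add_distrib, meanGrad, map_sum]
  refine (congrArg₂ _ ?_ ?_).trans (zero_add _)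
  · rw [← h0]
    refine Finset.sum_congr rfl fun s _ => ?_
    rw [toDual_smul (phi _ _ _), smul_comm]
  · refine Finset.sum_congr rfl fun s _ => ?_
    rw [stochGrad_eq, toDual_smul (phi _ _ _), toDual_smul (cost s G + _), smul_comm]

lemma continuous_smul_prod (θ : ℝ) :
    Continuous fun x : Param n × Instance n => (θ • x.1, x.2) :=
  (continuous_fst.const_smul θ).prodMk continuous_snd

lemma continuous_phi_smul (θ : ℝ) (s : Solution n) :
    Continuous fun x : Param n × Instance n => phi (θ • x.1) x.2 s := by
  have h := (continuous_phi s).comp (continuous_smul_prod θ)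
  exact h

lemma continuous_log_phi_smul (θ : ℝ) (s : Solution n) :
    Continuous fun x : Param n × Instance n => Real.log (phi (θ • x.1) x.2 s) :=
  (continuous_phi_smul θ s).log fun x => (phi_pos (θ • x.1) x.2 s).ne'

lemma continuous_freeEnergy (lam θ : ℝ) :
    Continuous fun x : Param n × Instance n => freeEnergy lam θ x.1 x.2 := by
  simp only [freeEnergy]
  refine continuous_finsetSum _ fun s _ => ?_
  exact (continuous_phi_smul θ s).mul
    (((continuous_cost s).comp continuous_snd).add
      (continuous_const.mul (continuous_log_phi_smul θ s)))

lemma continuous_meanGrad (lam θ : ℝ) :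
    Continuous fun x : Param n × Instance n => meanGrad lam θ x.1 x.2 :=
  continuous_finsetSum _ fun s _ =>
    (continuous_phi_smul θ s).smul (continuous_stochGrad lam θ s)

lemma continuous_sum_phi_mul_log :
    Continuous fun x : Param n × Instance n =>
      ∑ s, phi x.1 x.2 s * Real.log (phi x.1 x.2 s) :=
  continuous_finsetSum _ fun s _ => (continuous_phi s).mul (continuous_log_phi s)

lemma continuous_sum_generator_mul_cost (β ρ : ℝ) :
    Continuous fun x : Param n × Instance n =>
      ∑ s, generator β ρ x.1 x.2 s * cost s x.2 :=
  continuous_finsetSum _ fun s _ =>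
    ((continuous_const.mul (continuous_phi s)).add
      (continuous_const.mul (continuous_phi_smul ρ s))).mul
      ((continuous_cost s).comp continuous_snd)

lemma regLoss_eq_integral (β ρ lam : ℝ) (R : Measure (Instance n)) [IsProbabilityMeasure R]
    (W : Param n) : regLoss β ρ lam R W
      = ∫ G, ((1 - β) * freeEnergy lam 1 W G + β * freeEnergy lam ρ W G) ∂ R := by
  have hW : ∀ W : Param n, Continuous fun G : Instance n => (W, G) := fun W =>
    Continuous.prodMk_right W
  have i1 := integrable_of_continuous_instance R
    ((continuous_sum_generator_mul_cost β ρ).comp (hW W))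
  have i2 := integrable_of_continuous_instance R (continuous_sum_phi_mul_log.comp (hW W))
  have i3 := integrable_of_continuous_instance R (continuous_sum_phi_mul_log.comp (hW (ρ • W)))
  simp only [Function.comp_def] at i1 i2 i3
  have h1 := integral_const_mul (μ := R) (1 - β)
    fun G => ∑ s, phi W G s * Real.log (phi W G s)
  have h2 := integral_const_mul (μ := R) (β / ρ)
    fun G => ∑ s, phi (ρ • W) G s * Real.log (phi (ρ • W) G s)
  have i4 := (i2.const_mul (1 - β)).add (i3.const_mul (β / ρ))
  have h3 := integral_add (i2.const_mul (1 - β)) (i3.const_mul (β / ρ))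
  rw [regLoss, loss, regularizer, negEntropy, negEntropy, ← h1, ← h2, ← h3,
    ← integral_const_mul]
  have h5 := integral_add i1 (i4.const_mul lam)
  simp only [Pi.add_apply] at h5
  rw [← h5]
  refine integral_congr_ae (Filter.Eventually.of_forall fun G => ?_)
  simp only [freeEnergy, generator, one_smul, Finset.mul_sum, ← Finset.sum_add_distrib]
  refine Finset.sum_congr rfl fun s _ => ?_
  ring

lemma sampleMean_stochGrad (β ρ lam : ℝ) (R : Measure (Instance n)) (W : Param n) :
    sampleMean β ρ R W (stochGrad lam W)
      = ∫ G, ((1 - β) • meanGrad lam 1 W G + β • meanGrad lam ρ W G) ∂ R := by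
  simp only [sampleMean, meanGrad, one_smul]

lemma continuous_mixture_meanGrad (β ρ lam : ℝ) :
    Continuous fun x : Param n × Instance n =>
      (1 - β) • meanGrad lam 1 x.1 x.2 + β • meanGrad lam ρ x.1 x.2 :=
  ((continuous_meanGrad lam 1).const_smul (1 - β)).add ((continuous_meanGrad lam ρ).const_smul β)

lemma continuous_mixture_freeEnergy (β ρ lam : ℝ) :
    Continuous fun x : Param n × Instance n =>
      (1 - β) * freeEnergy lam 1 x.1 x.2 + β * freeEnergy lam ρ x.1 x.2 :=
  ((continuous_freeEnergy lam 1).const_mul (1 - β)).add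
    ((continuous_freeEnergy lam ρ).const_mul β)

lemma integrable_mixture_freeEnergy (β ρ lam : ℝ) (R : Measure (Instance n))
    [IsProbabilityMeasure R] (W : Param n) :
    Integrable (fun G => (1 - β) * freeEnergy lam 1 W G + β * freeEnergy lam ρ W G) R := by
  have h := (continuous_mixture_freeEnergy β ρ lam).comp (Continuous.prodMk_right W)
  exact integrable_of_continuous_instance R h

lemma integrable_mixture_meanGrad (β ρ lam : ℝ) (R : Measure (Instance n))
    [IsProbabilityMeasure R] (W : Param n) :
    Integrable (fun G => (1 - β) • meanGrad lam 1 W G + β • meanGrad lam ρ W G) R := by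
  have h := (continuous_mixture_meanGrad β ρ lam).comp (Continuous.prodMk_right W)
  exact integrable_of_continuous_instance R h

/-- The stochastic gradient is an unbiased estimate of the gradient of the regularized loss. -/
lemma hasGradientAt_regLoss (β ρ lam : ℝ) (R : Measure (Instance n)) [IsProbabilityMeasure R]
    (W : Param n) :
    HasGradientAt (regLoss β ρ lam R) (sampleMean β ρ R W (stochGrad lam W)) W := by
  rw [sampleMean_stochGrad, show regLoss β ρ lam R = fun V => ∫ G, ((1 - β) * freeEnergy lam 1 V G
    + β * freeEnergy lam ρ V G) ∂ R from funext fun V => regLoss_eq_integral β ρ lam R V]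
  refine hasGradientAt_integral R
    (f := fun V G => (1 - β) * freeEnergy lam 1 V G + β * freeEnergy lam ρ V G)
    (g := fun V G => (1 - β) • meanGrad lam 1 V G + β • meanGrad lam ρ V G)
    (fun V => by
      have h := (continuous_mixture_freeEnergy β ρ lam).comp (Continuous.prodMk_right V)
      exact h)
    (continuous_mixture_meanGrad β ρ lam) (fun V G => ?_) W
  have h := ((hasGradientAt_freeEnergy lam 1 V G).hasFDerivAt.const_mul (1 - β)).add
    ((hasGradientAt_freeEnergy lam ρ V G).hasFDerivAt.const_mul β)
  rw [hasGradientAt_iff_hasFDerivAt]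
  refine h.congr_fderiv ?_
  rw [map_add, toDual_smul, toDual_smul]

lemma continuous_regLoss (β ρ lam : ℝ) (R : Measure (Instance n)) [IsProbabilityMeasure R] :
    Continuous (regLoss β ρ lam R) :=
  continuous_iff_continuousAt.2 fun W => (hasGradientAt_regLoss β ρ lam R W).continuousAt

lemma continuous_loss (β ρ : ℝ) (R : Measure (Instance n)) [IsProbabilityMeasure R] :
    Continuous (loss β ρ R) :=
  continuous_integral_instance R (continuous_sum_generator_mul_cost β ρ)

lemma negEntropy_nonpos (R : Measure (Instance n)) (W : Param n) : negEntropy R W ≤ 0 := by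
  refine integral_nonpos fun G => Finset.sum_nonpos fun s _ => ?_
  exact mul_nonpos_of_nonneg_of_nonpos (phi_pos W G s).le (log_phi_nonpos W G s)

/-- Nonnegativity of the relative entropy to the uniform distribution, with `log 2 ≤ 1`. -/
lemma neg_le_negEntropy (R : Measure (Instance n)) [IsProbabilityMeasure R] (W : Param n) :
    -(n : ℝ) ≤ negEntropy R W := by
  have h : ∀ G : Instance n, -(n : ℝ) ≤ ∑ s, phi W G s * Real.log (phi W G s) := by
    intro G
    have h1 := sum_mul_log_sub_log_nonneg (phi_pos W G) (q := fun _ => 1 / 2 ^ n)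
      (fun _ => by positivity) (by
        rw [sum_phi, Finset.sum_const, Finset.card_univ, nsmul_eq_mul, card_solution]
        field_simp)
    simp only [mul_sub, Finset.sum_sub_distrib, ← Finset.sum_mul, sum_phi, one_mul, one_div,
      Real.log_inv, Real.log_pow] at h1
    have h2 : (n : ℝ) * Real.log 2 ≤ n * 1 := by
      gcongr
      linarith [Real.log_two_lt_d9]
    linarith
  calc -(n : ℝ) = ∫ _G, -(n : ℝ) ∂ R := by simp
    _ ≤ _ := integral_mono (integrable_const _) (integrable_of_continuous_instance R
        (continuous_sum_phi_mul_log.comp (Continuous.prodMk_right W))) h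

lemma regularizer_nonpos {β ρ : ℝ} (hβ : 0 < β) (hβ1 : β < 1) (hρ : 0 < ρ)
    (R : Measure (Instance n)) (W : Param n) : regularizer β ρ R W ≤ 0 :=
  add_nonpos (mul_nonpos_of_nonneg_of_nonpos (by linarith) (negEntropy_nonpos R W))
    (mul_nonpos_of_nonneg_of_nonpos (by positivity) (negEntropy_nonpos R _))

lemma neg_le_regularizer {β ρ : ℝ} (hβ : 0 < β) (hβ1 : β < 1) (hρ : 0 < ρ)
    (R : Measure (Instance n)) [IsProbabilityMeasure R] (W : Param n) :
    -((1 + β / ρ) * n) ≤ regularizer β ρ R W := by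
  have h1 := mul_le_mul_of_nonneg_left (neg_le_negEntropy R W) (show 0 ≤ 1 - β by linarith)
  have h2 := mul_le_mul_of_nonneg_left (neg_le_negEntropy R (ρ • W))
    (show 0 ≤ β / ρ by positivity)
  have h3 : 0 ≤ β * (n : ℝ) := by positivity
  rw [regularizer]
  nlinarith

/-- Gibbs' variational principle: the target parameter minimizes the regularized loss. -/
lemma regLoss_target_le {β ρ lam : ℝ} (hl : 0 < lam) (hβ : 0 < β) (hβ1 : β < 1) (hρ : 0 < ρ)
    (R : Measure (Instance n)) [IsProbabilityMeasure R] (W : Param n) :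
    regLoss β ρ lam R (target n lam) ≤ regLoss β ρ lam R W := by
  rw [regLoss_eq_integral, regLoss_eq_integral]
  have hc := integrable_mixture_freeEnergy β ρ lam R
  refine integral_mono (hc _) (hc _) fun G => ?_
  exact add_le_add
    (mul_le_mul_of_nonneg_left (freeEnergy_target_le hl one_pos W G) (by linarith))
    (mul_le_mul_of_nonneg_left (freeEnergy_target_le hl hρ W G) hβ.le)

lemma regLoss_target_le_opt {β ρ lam : ℝ} (hl : 0 < lam) (hβ : 0 < β) (hβ1 : β < 1) (hρ : 0 < ρ)
    (R : Measure (Instance n)) [IsProbabilityMeasure R] :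
    regLoss β ρ lam R (target n lam) ≤ opt R := by
  rw [regLoss_eq_integral, opt]
  have hinf : Continuous fun G : Instance n => ⨅ s : Solution n, cost s G := by
    simp only [← Finset.inf'_univ_eq_ciInf]
    exact Continuous.finset_inf'_apply _ fun s _ => continuous_cost s
  refine integral_mono (integrable_mixture_freeEnergy β ρ lam R _)
    (integrable_of_continuous_instance R hinf) fun G => ?_
  refine le_ciInf fun s => ?_
  have h1 := mul_le_mul_of_nonneg_left (freeEnergy_target_le_cost hl one_pos G s)
    (show 0 ≤ 1 - β by linarith)
  have h2 := mul_le_mul_of_nonneg_left (freeEnergy_target_le_cost hl hρ G s) hβ.le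
  linarith

lemma inner_sampleMean_stochGrad (β ρ lam : ℝ) (R : Measure (Instance n))
    [IsProbabilityMeasure R] (W v : Param n) :
    inner ℝ (sampleMean β ρ R W (stochGrad lam W)) v
      = ∫ G, inner ℝ ((1 - β) • meanGrad lam 1 W G + β • meanGrad lam ρ W G) v ∂ R := by
  rw [sampleMean_stochGrad, real_inner_comm, ← integral_inner]
  · exact integral_congr_ae (Filter.Eventually.of_forall fun G => real_inner_comm _ _)
  · exact integrable_mixture_meanGrad β ρ lam R W

/-- Approximate quasar-convexity of the regularized loss around the target parameter. -/
lemma regLoss_sub_target_le {lam β ρ τ : ℝ} (hl : 0 < lam) (hβ : 0 < β) (hβ1 : β < 1)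
    (hρ : 0 < ρ) (hτ : 0 < τ) (R : Measure (Instance n)) [IsProbabilityMeasure R] (W : Param n)
    (hW : ρ * (((n : ℝ) + 1) ^ 3 * ‖W‖) ≤ 1) :
    regLoss β ρ lam R W - regLoss β ρ lam R (target n lam) ≤ lam * τ
      + 8 * (n : ℝ) ^ 2 / (τ * β * ρ) *
        inner ℝ (sampleMean β ρ R W (stochGrad lam W)) (W - target n lam) := by
  have hc := integrable_mixture_freeEnergy β ρ lam R
  have hg := (integrable_mixture_meanGrad β ρ lam R W).inner_const (𝕜 := ℝ) (W - target n lam)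
  rw [regLoss_eq_integral, regLoss_eq_integral, inner_sampleMean_stochGrad,
    ← integral_sub (hc _) (hc _)]
  calc _ ≤ ∫ G, (lam * τ + 8 * (n : ℝ) ^ 2 / (τ * β * ρ) *
        inner ℝ ((1 - β) • meanGrad lam 1 W G + β • meanGrad lam ρ W G) (W - target n lam)) ∂ R :=
        integral_mono ((hc _).sub (hc _)) ((integrable_const _).add (hg.const_mul _)) fun G =>
          mixture_freeEnergy_sub_le hl hβ hβ1 hρ hτ W G hW
    _ = _ := by
        rw [integral_add (integrable_const _) (hg.const_mul _), integral_const, probReal_univ,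
          one_smul]
        congr 1
        exact integral_const_mul _ _

/-! ### Projected SGD -/

lemma proj_eq {B : ℝ} (hB : 0 < B) (W : Param n) : proj B W = (B / max B ‖W‖) • W := by
  rw [proj]
  split_ifs with h
  · rw [max_eq_left h, div_self hB.ne', one_smul]
  · rw [max_eq_right (not_le.1 h).le]

lemma continuous_proj {B : ℝ} (hB : 0 < B) : Continuous (proj B : Param n → Param n) := by
  have h : (proj B : Param n → Param n) = fun W => (B / max B ‖W‖) • W :=
    funext fun W => proj_eq hB W
  rw [h]
  exact (continuous_const.div (continuous_const.max continuous_norm)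
    fun W => (lt_max_of_lt_left hB).ne').smul continuous_id

lemma proj_mem {B : ℝ} (hB : 0 < B) (W : Param n) : proj B W ∈ paramSpace n B := by
  rw [paramSpace, mem_closedBall_zero_iff, proj]
  split_ifs with h
  · exact h
  · have hW : 0 < ‖W‖ := hB.trans (not_le.1 h)
    rw [norm_smul, Real.norm_of_nonneg (by positivity), div_mul_cancel₀ _ hW.ne']

lemma norm_proj_sub_sq_le {B : ℝ} (hB : 0 < B) (W : Param n) {w : Param n}
    (hw : w ∈ paramSpace n B) : ‖proj B W - w‖ ^ 2 ≤ ‖W - w‖ ^ 2 := by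
  rw [paramSpace, mem_closedBall_zero_iff] at hw
  rw [proj]
  split_ifs with h
  · exact le_rfl
  · have hlt := not_le.1 h
    have hW : 0 < ‖W‖ := hB.trans hlt
    have hi := (real_inner_le_norm W w).trans (mul_le_mul_of_nonneg_left hw hW.le)
    rw [norm_sub_sq_real, norm_sub_sq_real, norm_smul, Real.norm_of_nonneg (by positivity),
      div_mul_cancel₀ _ hW.ne', inner_smul_left, conj_trivial]
    have h1 : 0 ≤ 1 - B / ‖W‖ := by
      rw [sub_nonneg, div_le_one hW]
      exact hlt.le
    have h2 : B / ‖W‖ * ‖W‖ = B := div_mul_cancel₀ _ hW.ne'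
    have h3 := mul_le_mul_of_nonneg_left hi h1
    have h4 : (1 - B / ‖W‖) * (‖W‖ * B) = ‖W‖ * B - B ^ 2 := by
      rw [sub_mul, ← mul_assoc (B / _), h2]
      ring
    -- The squared distance to `w` drops by at least `(‖W‖ - B) ^ 2`.
    nlinarith [sq_nonneg (‖W‖ - B)]

/-- The next iterate of projected SGD from `W` and the sample `(θ, G, s)`. -/
def sgdNext (lam B η : ℝ) (W : Param n) (θ : ℝ) (G : Instance n) (s : Solution n) : Param n :=
  proj B (W - η • stochGrad lam W θ G s)

lemma continuous_sgdNext {B : ℝ} (hB : 0 < B) (lam η θ : ℝ) (s : Solution n) :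
    Continuous fun x : Param n × Instance n => sgdNext lam B η x.1 θ x.2 s :=
  (continuous_proj hB).comp
    (continuous_fst.sub ((continuous_stochGrad lam θ s).const_smul η))

/-- The mean of a function over the mixture component and the solution of a sample, given the
instance. -/
def condMean (β ρ : ℝ) (W : Param n) (G : Instance n) (f : ℝ → Solution n → ℝ) : ℝ :=
  (1 - β) * ∑ s, phi W G s * f 1 s + β * ∑ s, phi (ρ • W) G s * f ρ s

lemma condMean_mono {β ρ : ℝ} (hβ : 0 ≤ β) (hβ1 : β ≤ 1) (W : Param n) (G : Instance n)
    {f g : ℝ → Solution n → ℝ} (h1 : ∀ s, f 1 s ≤ g 1 s) (hρ : ∀ s, f ρ s ≤ g ρ s) :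
    condMean β ρ W G f ≤ condMean β ρ W G g :=
  add_le_add
    (mul_le_mul_of_nonneg_left (Finset.sum_le_sum fun s _ =>
      mul_le_mul_of_nonneg_left (h1 s) (phi_pos _ _ _).le) (by linarith))
    (mul_le_mul_of_nonneg_left (Finset.sum_le_sum fun s _ =>
      mul_le_mul_of_nonneg_left (hρ s) (phi_pos _ _ _).le) hβ)

lemma condMean_affine (β ρ : ℝ) (W : Param n) (G : Instance n) (a c : ℝ)
    (f g : ℝ → Solution n → ℝ) :
    condMean β ρ W G (fun θ s => a + c * (f θ s - g θ s))
      = a + c * (condMean β ρ W G f - condMean β ρ W G g) := by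
  simp only [condMean, mul_add, mul_sub, Finset.sum_add_distrib, Finset.sum_sub_distrib,
    ← Finset.sum_mul, sum_phi, mul_left_comm _ c, ← Finset.mul_sum]
  ring

lemma sgdStep_eq (β ρ lam B η : ℝ) (R : Measure (Instance n)) (F : Param n → ℝ) (W : Param n) :
    sgdStep β ρ lam B η R F W
      = ∫ G, condMean β ρ W G (fun θ s => F (sgdNext lam B η W θ G s)) ∂ R := rfl

lemma continuous_condMean_sgdNext {β ρ lam B η : ℝ} (hB : 0 < B) {F : Param n → ℝ}
    (hF : Continuous F) : Continuous fun x : Param n × Instance n =>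
      condMean β ρ x.1 x.2 (fun θ s => F (sgdNext lam B η x.1 θ x.2 s)) := by
  have h := fun θ s => hF.comp (continuous_sgdNext (n := n) hB lam η θ s)
  simp only [condMean]
  exact ((continuous_finsetSum _ fun s _ => (continuous_phi s).mul (h 1 s)).const_mul _).add
    ((continuous_finsetSum _ fun s _ => (continuous_phi_smul ρ s).mul (h ρ s)).const_mul _)

lemma continuous_sgdStep {β ρ lam B η : ℝ} (hB : 0 < B) (R : Measure (Instance n))
    [IsProbabilityMeasure R] {F : Param n → ℝ} (hF : Continuous F) :
    Continuous (sgdStep β ρ lam B η R F) :=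
  continuous_integral_instance R (continuous_condMean_sgdNext hB hF)

lemma integrable_condMean_sgdNext {β ρ lam B η : ℝ} (hB : 0 < B) (R : Measure (Instance n))
    [IsProbabilityMeasure R] {F : Param n → ℝ} (hF : Continuous F) (W : Param n) :
    Integrable (fun G => condMean β ρ W G (fun θ s => F (sgdNext lam B η W θ G s))) R := by
  have h := (continuous_condMean_sgdNext (β := β) (ρ := ρ) (lam := lam) (η := η) hB hF).comp
    (Continuous.prodMk_right W)
  exact integrable_of_continuous_instance R h

/-- Comparison on the ball suffices even for `W` outside it, because the next iterate is projected.
-/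
lemma sgdStep_mono {β ρ lam B η : ℝ} (hβ : 0 ≤ β) (hβ1 : β ≤ 1) (hB : 0 < B)
    (R : Measure (Instance n)) [IsProbabilityMeasure R] {F H : Param n → ℝ} (hF : Continuous F)
    (hH : Continuous H) (h : ∀ W ∈ paramSpace n B, F W ≤ H W) (W : Param n) :
    sgdStep β ρ lam B η R F W ≤ sgdStep β ρ lam B η R H W := by
  rw [sgdStep_eq, sgdStep_eq]
  refine integral_mono (integrable_condMean_sgdNext hB R hF W)
    (integrable_condMean_sgdNext hB R hH W) fun G => ?_
  apply condMean_mono hβ hβ1 W G <;> exact fun _ => h _ (proj_mem hB _)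

/-- The form `a + c * (F - H)` is that of the one-step bound with a potential difference, which has
to be propagated along the chain. -/
lemma sgdStep_affine {β ρ lam B η : ℝ} (hB : 0 < B) (R : Measure (Instance n))
    [IsProbabilityMeasure R] {F H : Param n → ℝ} (hF : Continuous F) (hH : Continuous H)
    (a c : ℝ) : sgdStep β ρ lam B η R (fun W => a + c * (F W - H W))
      = fun W => a + c * (sgdStep β ρ lam B η R F W - sgdStep β ρ lam B η R H W) := by
  funext W
  have i1 := integrable_condMean_sgdNext (β := β) (ρ := ρ) (lam := lam) (η := η) hB R hF W
  have i2 := integrable_condMean_sgdNext (β := β) (ρ := ρ) (lam := lam) (η := η) hB R hH W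
  simp only [sgdStep_eq, condMean_affine]
  have h := integral_add (integrable_const a) ((i1.sub i2).const_mul c)
  simp only [Pi.sub_apply] at h
  rw [h, integral_const, probReal_univ, one_smul, ← integral_sub i1 i2]
  congr 1
  exact integral_const_mul _ _

lemma continuous_sgdMean {β ρ lam B η : ℝ} (hB : 0 < B) (R : Measure (Instance n))
    [IsProbabilityMeasure R] (t : ℕ) {F : Param n → ℝ} (hF : Continuous F) :
    Continuous (sgdMean β ρ lam B η R t F) := by
  induction t generalizing F with
  | zero => exact hF
  | succ t ih => exact ih (continuous_sgdStep hB R hF)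

lemma sgdMean_succ (β ρ lam B η : ℝ) (R : Measure (Instance n)) (t : ℕ) (F : Param n → ℝ) :
    sgdMean β ρ lam B η R (t + 1) F = sgdStep β ρ lam B η R (sgdMean β ρ lam B η R t F) :=
  Function.iterate_succ_apply' _ _ _

lemma sgdMean_mono {β ρ lam B η : ℝ} (hβ : 0 ≤ β) (hβ1 : β ≤ 1) (hB : 0 < B)
    (R : Measure (Instance n)) [IsProbabilityMeasure R] (t : ℕ) {F H : Param n → ℝ}
    (hF : Continuous F) (hH : Continuous H) (h : ∀ W ∈ paramSpace n B, F W ≤ H W) {W : Param n}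
    (hW : W ∈ paramSpace n B) :
    sgdMean β ρ lam B η R t F W ≤ sgdMean β ρ lam B η R t H W := by
  induction t generalizing W with
  | zero => exact h W hW
  | succ t ih =>
    rw [sgdMean_succ, sgdMean_succ]
    exact sgdStep_mono hβ hβ1 hB R (continuous_sgdMean hB R t hF) (continuous_sgdMean hB R t hH)
      (fun V hV => ih hV) W

lemma sgdMean_affine {β ρ lam B η : ℝ} (hB : 0 < B) (R : Measure (Instance n))
    [IsProbabilityMeasure R] (t : ℕ) {F H : Param n → ℝ} (hF : Continuous F) (hH : Continuous H)
    (a c : ℝ) : sgdMean β ρ lam B η R t (fun W => a + c * (F W - H W))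
      = fun W => a + c * (sgdMean β ρ lam B η R t F W - sgdMean β ρ lam B η R t H W) := by
  induction t with
  | zero => rfl
  | succ t ih =>
    simp only [sgdMean_succ, ih]
    exact sgdStep_affine hB R (continuous_sgdMean hB R t hF) (continuous_sgdMean hB R t hH) a c

lemma sgdMean_const {β ρ lam B η : ℝ} (hB : 0 < B) (R : Measure (Instance n))
    [IsProbabilityMeasure R] (t : ℕ) (a : ℝ) :
    sgdMean β ρ lam B η R t (fun _ => a) = fun _ => a := by
  have h := sgdMean_affine (β := β) (ρ := ρ) (lam := lam) (η := η) hB R t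
    (continuous_const (y := (0 : ℝ))) (continuous_const (y := (0 : ℝ))) a 0
  simpa using h

/-- If `F` is bounded by the expected one-step decrease of a potential with values in `[0, D]`,
then the average of `F` along the iterates is bounded. -/
lemma sgdAverage_le {β ρ lam B η : ℝ} (hβ : 0 ≤ β) (hβ1 : β ≤ 1) (hB : 0 < B)
    (R : Measure (Instance n)) [IsProbabilityMeasure R] {F V : Param n → ℝ} (hF : Continuous F)
    (hV : Continuous V) {a c D : ℝ} (hc : 0 ≤ c) (hV0 : ∀ W ∈ paramSpace n B, 0 ≤ V W)
    (hVD : ∀ W ∈ paramSpace n B, V W ≤ D)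
    (h : ∀ W ∈ paramSpace n B, F W ≤ a + c * (V W - sgdStep β ρ lam B η R V W))
    {T : ℕ} (hT : 0 < T) {W₀ : Param n} (hW₀ : W₀ ∈ paramSpace n B) :
    sgdAverage β ρ lam B η R T F W₀ ≤ a + c * D / T := by
  have hPV := continuous_sgdStep (β := β) (ρ := ρ) (lam := lam) (η := η) hB R hV
  have h1 : ∀ t, sgdMean β ρ lam B η R t F W₀ ≤ a + c * (sgdMean β ρ lam B η R t V W₀
      - sgdMean β ρ lam B η R (t + 1) V W₀) := by
    intro t
    have h2 := sgdMean_mono (ρ := ρ) (lam := lam) (η := η) hβ hβ1 hB R t hF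
      (continuous_const.add ((hV.sub hPV).const_mul c)) h hW₀
    have h3 := congrFun (sgdMean_affine (β := β) (ρ := ρ) (lam := lam) (η := η) hB R t hV hPV a c)
      W₀
    exact h2.trans_eq h3
  -- The average starts at `t = 1`, so the sum telescopes from time `1` to time `T + 1`.
  have h2 : ∀ T, ∑ t ∈ Finset.Icc 1 T, sgdMean β ρ lam B η R t F W₀ ≤ T * a
      + c * (sgdMean β ρ lam B η R 1 V W₀ - sgdMean β ρ lam B η R (T + 1) V W₀) := by
    intro T
    induction T with
    | zero => simp
    | succ T ih =>
      rw [Finset.sum_Icc_succ_top (by omega)]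
      have := h1 (T + 1)
      push_cast
      linarith
  have h3 : sgdMean β ρ lam B η R 1 V W₀ ≤ D := by
    have := sgdMean_mono (ρ := ρ) (lam := lam) (η := η) hβ hβ1 hB R 1 hV continuous_const hVD hW₀
    rwa [sgdMean_const hB] at this
  have h4 : 0 ≤ sgdMean β ρ lam B η R (T + 1) V W₀ := by
    have := sgdMean_mono (ρ := ρ) (lam := lam) (η := η) hβ hβ1 hB R (T + 1) continuous_const hV
      hV0 hW₀
    rwa [sgdMean_const hB] at this
  have hT' : (0 : ℝ) < T := by exact_mod_cast hT
  rw [sgdAverage, div_le_iff₀ hT', add_mul, div_mul_cancel₀ _ hT'.ne']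
  have h5 := mul_le_mul_of_nonneg_left (show sgdMean β ρ lam B η R 1 V W₀
    - sgdMean β ρ lam B η R (T + 1) V W₀ ≤ D by linarith) hc
  linarith [h2 T]

/-- The one-step inequality of projected SGD for the squared distance to a point of the parameter
space. -/
lemma sgdStep_sq_dist_le {β ρ lam B η M : ℝ} (hβ : 0 ≤ β) (hβ1 : β ≤ 1) (hB : 0 < B)
    (R : Measure (Instance n)) [IsProbabilityMeasure R] {W w : Param n}
    (hw : w ∈ paramSpace n B) (hM1 : ∀ G s, ‖stochGrad lam W 1 G s‖ ≤ M)
    (hMρ : ∀ G s, ‖stochGrad lam W ρ G s‖ ≤ M) :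
    sgdStep β ρ lam B η R (fun V => ‖V - w‖ ^ 2) W ≤ ‖W - w‖ ^ 2 + η ^ 2 * M ^ 2
      - 2 * η * inner ℝ (sampleMean β ρ R W (stochGrad lam W)) (W - w) := by
  -- The form `0 - inner` matches `condMean_affine` with the zero function in first place.
  have hstep : ∀ (θ : ℝ) (G : Instance n) (s : Solution n), ‖stochGrad lam W θ G s‖ ≤ M →
      ‖sgdNext lam B η W θ G s - w‖ ^ 2 ≤ (‖W - w‖ ^ 2 + η ^ 2 * M ^ 2)
        + (2 * η) * (0 - inner ℝ (stochGrad lam W θ G s) (W - w)) := by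
    intro θ G s hM
    refine (norm_proj_sub_sq_le hB _ hw).trans ?_
    rw [sub_right_comm, norm_sub_sq_real, norm_smul, inner_smul_right, mul_pow, Real.norm_eq_abs,
      sq_abs, real_inner_comm]
    have : η ^ 2 * ‖stochGrad lam W θ G s‖ ^ 2 ≤ η ^ 2 * M ^ 2 := by gcongr
    linarith
  have hV : Continuous fun V : Param n => ‖V - w‖ ^ 2 :=
    ((continuous_id.sub continuous_const).norm).pow 2
  have hi := (integrable_mixture_meanGrad β ρ lam R W).inner_const (𝕜 := ℝ) (W - w)
  rw [sgdStep_eq, inner_sampleMean_stochGrad]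
  calc _ ≤ ∫ G, ((‖W - w‖ ^ 2 + η ^ 2 * M ^ 2) + -(2 * η) *
        inner ℝ ((1 - β) • meanGrad lam 1 W G + β • meanGrad lam ρ W G) (W - w)) ∂ R := by
        refine integral_mono (integrable_condMean_sgdNext hB R hV W)
          ((integrable_const _).add (hi.const_mul _)) fun G => ?_
        refine (condMean_mono (g := fun θ s => (‖W - w‖ ^ 2 + η ^ 2 * M ^ 2)
          + (2 * η) * (0 - inner ℝ (stochGrad lam W θ G s) (W - w))) hβ hβ1 W G
          (fun s => hstep 1 G s (hM1 G s)) fun s => hstep ρ G s (hMρ G s)).trans_eq ?_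
        rw [condMean_affine β ρ W G _ _ (fun _ _ => 0)]
        simp only [condMean, meanGrad, inner_add_left, inner_smul_left, sum_inner, conj_trivial,
          mul_zero, Finset.sum_const_zero, one_smul]
        ring
    _ = _ := by
        rw [integral_add (integrable_const _) (hi.const_mul _), integral_const, probReal_univ,
          one_smul, integral_const_mul]
        ring

/-- The score part of `log φ` scales with `θ` and cancels `1 / θ`; only the entropy term `n` keeps
the factor `lam / θ`. -/
lemma norm_stochGrad_le {lam θ : ℝ} (hl : 0 < lam) (hθ : 0 < θ) (hθ1 : θ ≤ 1) (W : Param n)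
    (G : Instance n) (s : Solution n) :
    ‖stochGrad lam W θ G s‖ ≤ (((n : ℝ) + 1) ^ 3 + (lam / θ * n
      + 2 * lam * (((n : ℝ) + 1) ^ 3 * ‖W‖))) * (2 * ((n : ℝ) + 1) ^ 3) := by
  have h1 := abs_log_phi_le (W := θ • W) (G := G) (a := θ * (((n : ℝ) + 1) ^ 3 * ‖W‖)) (fun t => by
    rw [score_smul, abs_mul, abs_of_pos hθ]
    exact mul_le_mul_of_nonneg_left (abs_score_le W G t) hθ.le) s
  rw [stochGrad_eq, norm_smul, Real.norm_eq_abs, norm_smul, Real.norm_of_nonneg hθ.le]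
  have h2 : |cost s G + lam / θ * Real.log (phi (θ • W) G s)| ≤ ((n : ℝ) + 1) ^ 3
      + (lam / θ * n + 2 * lam * (((n : ℝ) + 1) ^ 3 * ‖W‖)) := by
    refine (abs_add_le _ _).trans (add_le_add (abs_cost_le s G) ?_)
    rw [abs_mul, abs_of_pos (div_pos hl hθ)]
    refine (mul_le_mul_of_nonneg_left h1 (div_pos hl hθ).le).trans_eq ?_
    field_simp
  have h3 : ‖feat G s - meanFeat (θ • W) G‖ ≤ 2 * ((n : ℝ) + 1) ^ 3 :=
    (norm_sub_le _ _).trans (by linarith [norm_feat_le G s, norm_meanFeat_le (θ • W) G])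
  have h4 : θ * ‖feat G s - meanFeat (θ • W) G‖ ≤ 2 * ((n : ℝ) + 1) ^ 3 :=
    (mul_le_of_le_one_left (norm_nonneg _) hθ1).trans h3
  exact mul_le_mul h2 h4 (by positivity) ((abs_nonneg _).trans h2)

/-! ### Description length -/

/-- A ball of radius `B` in `EuclideanSpace ℝ ι` is covered by `2 ^ (l * card ι)` grid cells of
diameter at most `δ` as soon as `2 B (card ι + 1) < 2 ^ l * δ`. -/
lemma coveringNumber_closedBall_le {ι : Type*} [Fintype ι] {B : ℝ} {δ : NNReal} (hδ : 0 < δ)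
    (l : ℕ) (hl : 2 * B * (Fintype.card ι + 1) < 2 ^ l * δ) :
    Metric.coveringNumber δ (Metric.closedBall (0 : EuclideanSpace ℝ ι) B)
      ≤ ((2 ^ (l * Fintype.card ι) : ℕ) : ℕ∞) := by
  classical
  refine (Metric.coveringNumber_le_packingNumber δ _).trans ?_
  simp only [Metric.packingNumber, iSup_le_iff]
  intro C hC hsep
  -- With this cell width, two points in the same cell are at distance at most `δ`. A `δ`-separated
  -- set therefore injects into the cells. The `+ 1` avoids dividing by zero in dimension `0`.
  set h : ℝ := δ / (Fintype.card ι + 1) with hh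
  have hd : (0 : ℝ) < Fintype.card ι + 1 := by positivity
  have hδ' : (0 : ℝ) < δ := hδ
  have hpos : 0 < h := div_pos hδ' hd
  have hcoord : ∀ x ∈ C, ∀ i, |x i| ≤ B := fun x hx i =>
    (PiLp.norm_apply_le x i).trans (mem_closedBall_zero_iff.1 (hC hx))
  have hlt : ∀ x ∈ C, ∀ i, ⌊(x i + B) / h⌋₊ < 2 ^ l := by
    intro x hx i
    have h1 := abs_le.1 (hcoord x hx i)
    rw [Nat.floor_lt (div_nonneg (by linarith) hpos.le), div_lt_iff₀ hpos]
    push_cast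
    rw [hh, ← mul_div_assoc, lt_div_iff₀ hd]
    refine lt_of_le_of_lt ?_ hl
    exact mul_le_mul_of_nonneg_right (by linarith) hd.le
  let f : C → ι → Fin (2 ^ l) := fun x i => ⟨⌊(x.1 i + B) / h⌋₊, hlt x.1 x.2 i⟩
  have hf : Function.Injective f := by
    intro x y hxy
    by_contra hne
    have h1 := hsep x.2 y.2 (fun h => hne (Subtype.ext h))
    refine absurd h1 (not_lt.2 ?_)
    rw [edist_dist, ← ENNReal.ofReal_coe_nnreal]
    refine ENNReal.ofReal_le_ofReal ?_
    rw [dist_eq_norm]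
    have h2 : ∀ i, |(x.1 - y.1) i| ≤ h := by
      intro i
      have h3 : ⌊(x.1 i + B) / h⌋₊ = ⌊(y.1 i + B) / h⌋₊ := congrArg Fin.val (congrFun hxy i)
      have hx := abs_le.1 (hcoord x.1 x.2 i)
      have hy := abs_le.1 (hcoord y.1 y.2 i)
      have hx1 := Nat.floor_le (div_nonneg (show 0 ≤ x.1 i + B by linarith) hpos.le)
      have hx2 := Nat.lt_floor_add_one ((x.1 i + B) / h)
      have hy1 := Nat.floor_le (div_nonneg (show 0 ≤ y.1 i + B by linarith) hpos.le)
      have hy2 := Nat.lt_floor_add_one ((y.1 i + B) / h)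
      rw [h3] at hx1 hx2
      rw [le_div_iff₀ hpos] at hx1 hy1
      rw [div_lt_iff₀ hpos] at hx2 hy2
      rw [PiLp.sub_apply, abs_le]
      constructor <;> linarith
    calc ‖(x.1 - y.1)‖ ≤ (Fintype.card ι + 1) * h := by
          refine abs_le_of_sq_le_sq' ?_ (by positivity) |>.2
          rw [EuclideanSpace.norm_sq_eq]
          calc ∑ i, ‖(x.1 - y.1) i‖ ^ 2 ≤ ∑ _i : ι, h ^ 2 :=
                Finset.sum_le_sum fun i _ => by
                  have := h2 i
                  rw [← Real.norm_eq_abs] at this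
                  gcongr
            _ = Fintype.card ι * h ^ 2 := by simp
            _ ≤ _ := by
                rw [mul_pow]
                gcongr
                nlinarith [Nat.cast_nonneg (α := ℝ) (Fintype.card ι)]
      _ = δ := by rw [hh]; field_simp
  have hcard : C.encard ≤ ENat.card (ι → Fin (2 ^ l)) := by
    rw [Set.encard]
    exact ENat.card_le_card_of_injective hf
  refine hcard.trans (le_of_eq ?_)
  rw [ENat.card_eq_coe_fintype_card]
  simp [pow_mul]

/-- From `2 ^ (size - 1) ≤ k` and `log 2 ≥ 1 / 2`. -/
lemma natSize_le_log {k : ℕ} (hk : 1 ≤ k) : (Nat.size k : ℝ) ≤ 1 + 2 * Real.log k := by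
  have hs : 0 < Nat.size k := Nat.size_pos.2 hk
  have h1 : 2 ^ (Nat.size k - 1) ≤ k := Nat.lt_size.1 (by omega)
  have h2 : ((Nat.size k - 1 : ℕ) : ℝ) * Real.log 2 ≤ Real.log k := by
    rw [← Real.log_pow]
    exact Real.log_le_log (by positivity) (by exact_mod_cast h1)
  rw [Nat.cast_sub hs, Nat.cast_one] at h2
  have h3 : (1 : ℝ) ≤ Nat.size k := by exact_mod_cast hs
  have h4 := mul_le_mul_of_nonneg_left
    (show (1 : ℝ) / 2 ≤ Real.log 2 by linarith [Real.log_two_gt_d9]) (sub_nonneg.2 h3)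
  linarith

lemma ratBits_natCast (k : ℕ) : ratBits (k : ℚ) = Nat.size k + 1 := by
  simp [ratBits]

lemma ratBits_one_div_natCast {k : ℕ} (hk : 1 ≤ k) :
    ratBits (1 / (k : ℚ)) = 1 + Nat.size k := by
  have h : k ≠ 0 := by omega
  simp [ratBits, h, Int.sign_natCast_of_ne_zero h]

lemma log_mul_pow_le {c : ℕ} (hc : 1 ≤ c) {a N m : ℝ} (ha : 0 < a) (hN : 1 ≤ N) (hm : 1 ≤ m) :
    Real.log (a * m * N ^ c) ≤ Real.log a + Real.log m + c * (N - 1) := by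
  have h0 : N ≠ 0 := by positivity
  have hm0 : m ≠ 0 := by positivity
  rw [Real.log_mul (by positivity) (by positivity), Real.log_mul ha.ne' hm0, Real.log_pow]
  gcongr
  exact Real.log_le_sub_one_of_pos (by linarith)

lemma exists_describedBy (n : ℕ) {m : ℕ} (hm : 1 ≤ m) {δ : NNReal} (hδ : 0 < δ) :
    ∃ b : ℕ, DescribedBy n (1 / ((4 * m * (n + 1) ^ 5 : ℕ) : ℚ))
        (1 / ((4 * m * (n + 1) ^ 5 : ℕ) : ℚ)) ((4 * m * (n + 1) ^ 2 : ℕ) : ℚ) δ b ∧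
      (b : ℝ) ≤ 77 * ((n : ℝ) + 1) ^ 5 * (1 + Real.log m) * (1 + Real.log (1 + 1 / (δ : ℝ))) := by
  set N : ℝ := (n : ℝ) + 1 with hN
  have hN1 : 1 ≤ N := by rw [hN]; linarith [Nat.cast_nonneg (α := ℝ) n]
  have hm1 : (1 : ℝ) ≤ m := by exact_mod_cast hm
  have hδ' : (0 : ℝ) < δ := hδ
  set Lm := Real.log m with hLm
  have hLm0 : 0 ≤ Lm := Real.log_nonneg hm1
  set Ld := Real.log (1 + 1 / (δ : ℝ)) with hLd
  have hd1 : 1 ≤ 1 + 1 / (δ : ℝ) := by linarith [one_div_pos.2 hδ']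
  have hLd0 : 0 ≤ Ld := Real.log_nonneg hd1
  set d : ℕ := Fintype.card ((Fin n × Fin n) × (Fin n × Fin n)) with hd
  have hdn : (d : ℝ) = (n : ℝ) ^ 4 := by
    rw [hd]
    simp only [Fintype.card_prod, Fintype.card_fin]
    push_cast
    ring
  have hdN : (d : ℝ) + 1 ≤ N ^ 4 := by
    rw [hdn, hN]
    have : (0 : ℝ) ≤ n := Nat.cast_nonneg n
    nlinarith [pow_nonneg this 2, pow_nonneg this 3]
  -- The number of grid cells needed per coordinate; `Nat.size k` bits index them in each of the `d`
  -- coordinates.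
  set z : ℝ := 2 * (4 * m * N ^ 2) * (d + 1) / δ with hz
  have hz0 : 0 < z := by positivity
  set k : ℕ := ⌈z⌉₊ with hk
  have hk1 : 1 ≤ k := Nat.ceil_pos.2 hz0
  have hlog4 : Real.log 4 ≤ 2 := by
    rw [show (4 : ℝ) = 2 * 2 by norm_num, Real.log_mul (by norm_num) (by norm_num)]
    linarith [Real.log_two_lt_d9]
  have hlog8 : Real.log 8 ≤ 3 := by
    rw [show (8 : ℝ) = 2 * 4 by norm_num, Real.log_mul (by norm_num) (by norm_num)]
    linarith [Real.log_two_lt_d9]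
  have s1 : (Nat.size (4 * m * (n + 1) ^ 5) : ℝ) ≤ 1 + 2 * (2 + Lm + 5 * (N - 1)) := by
    refine (natSize_le_log (Nat.mul_pos (by omega) (by positivity))).trans ?_
    push_cast
    have := log_mul_pow_le (c := 5) (by norm_num) (a := 4) (by norm_num) hN1 hm1
    push_cast at this
    linarith
  have s2 : (Nat.size (4 * m * (n + 1) ^ 2) : ℝ) ≤ 1 + 2 * (2 + Lm + 2 * (N - 1)) := by
    refine (natSize_le_log (Nat.mul_pos (by omega) (by positivity))).trans ?_
    push_cast
    have := log_mul_pow_le (c := 2) (by norm_num) (a := 4) (by norm_num) hN1 hm1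
    push_cast at this
    linarith
  have s3 : (Nat.size k : ℝ) ≤ 1 + 2 * (3 + Lm + 6 * (N - 1) + Ld) := by
    refine (natSize_le_log hk1).trans ?_
    have hkz : (k : ℝ) ≤ 8 * m * N ^ 6 * (1 + 1 / δ) := by
      have h1 : (k : ℝ) ≤ z + 1 := (Nat.ceil_lt_add_one hz0.le).le
      have h2 : 2 * (4 * m * N ^ 2) * (d + 1) ≤ 8 * m * N ^ 6 := by
        calc 2 * (4 * m * N ^ 2) * (d + 1) ≤ 2 * (4 * m * N ^ 2) * N ^ 4 := by gcongr
          _ = _ := by ring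
      have h3 : z ≤ 8 * m * N ^ 6 / δ := by rw [hz]; gcongr
      have h4 : 1 ≤ 8 * m * N ^ 6 := by
        have : 1 ≤ (m : ℝ) * N ^ 6 := one_le_mul_of_one_le_of_one_le hm1 (one_le_pow₀ hN1)
        linarith
      rw [mul_add, mul_one, mul_one_div]
      linarith
    have h5 : Real.log k ≤ Real.log (8 * m * N ^ 6) + Ld := by
      rw [hLd, ← Real.log_mul (by positivity) (by positivity)]
      exact Real.log_le_log (by exact_mod_cast hk1) hkz
    have := log_mul_pow_le (c := 6) (by norm_num) (a := 8) (by norm_num) hN1 hm1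
    push_cast at this
    linarith
  refine ⟨_, ⟨Nat.size k * d, ?_, le_rfl⟩, ?_⟩
  · refine coveringNumber_closedBall_le hδ _ ?_
    have h1 : (k : ℝ) < 2 ^ Nat.size k := by exact_mod_cast Nat.lt_size_self k
    have h2 : z < 2 ^ Nat.size k := (Nat.le_ceil z).trans_lt h1
    rw [hz, div_lt_iff₀ hδ'] at h2
    push_cast
    exact h2
  · rw [ratBits_one_div_natCast (Nat.mul_pos (by omega) (by positivity)), ratBits_natCast]
    push_cast
    have hP : 1 ≤ (1 + Lm) * (1 + Ld) := by nlinarith [mul_nonneg hLm0 hLd0]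
    have hQ : N ≤ N * ((1 + Lm) * (1 + Ld)) := by nlinarith
    have hR : Lm + Ld ≤ (1 + Lm) * (1 + Ld) - 1 := by nlinarith [mul_nonneg hLm0 hLd0]
    have hS : (1 + Lm) * (1 + Ld) ≤ N * ((1 + Lm) * (1 + Ld)) := by nlinarith
    -- The constant `77` is `3 * 17 + 23`, plus one extra bit for each of the three rationals.
    have t1 : 1 + 2 * (2 + Lm + 5 * (N - 1)) ≤ 17 * (N * ((1 + Lm) * (1 + Ld))) := by linarith
    have t2 : 1 + 2 * (2 + Lm + 2 * (N - 1)) ≤ 17 * (N * ((1 + Lm) * (1 + Ld))) := by linarith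
    have t3 : 1 + 2 * (3 + Lm + 6 * (N - 1) + Ld) ≤ 23 * (N * ((1 + Lm) * (1 + Ld))) := by
      linarith
    have t4 : (Nat.size k : ℝ) * d ≤ 23 * (N * ((1 + Lm) * (1 + Ld))) * N ^ 4 :=
      mul_le_mul (s3.trans t3) (by linarith) (by positivity) (by positivity)
    have t5 : N * ((1 + Lm) * (1 + Ld)) ≤ N * ((1 + Lm) * (1 + Ld)) * N ^ 4 :=
      le_mul_of_one_le_right (by positivity) (one_le_pow₀ hN1)
    have t6 : 77 * N ^ 5 * (1 + Lm) * (1 + Ld) = 77 * (N * ((1 + Lm) * (1 + Ld)) * N ^ 4) := by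
      ring
    rw [t6]
    linarith

/-! ### Choice of parameters and convergence -/

lemma target_mem_paramSpace (n : ℕ) {m : ℝ} (hm : 1 ≤ m) :
    target n (1 / (4 * m * ((n : ℝ) + 1))) ∈ paramSpace n (4 * m * ((n : ℝ) + 1) ^ 2) := by
  rw [paramSpace, mem_closedBall_zero_iff, norm_target (by positivity), div_div_eq_mul_div, div_one]
  have hn : (n : ℝ) ≤ n + 1 := by linarith
  calc (n : ℝ) * (4 * m * (n + 1)) ≤ (n + 1) * (4 * m * (n + 1)) := by gcongr
    _ = _ := by ring

lemma norm_stochGrad_le_pow {m θ : ℝ} (hm : 1 ≤ m)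
    (hθ : 1 / (4 * m * ((n : ℝ) + 1) ^ 5) ≤ θ) (hθ1 : θ ≤ 1) {W : Param n}
    (hW : W ∈ paramSpace n (4 * m * ((n : ℝ) + 1) ^ 2)) (G : Instance n) (s : Solution n) :
    ‖stochGrad (1 / (4 * m * ((n : ℝ) + 1))) W θ G s‖ ≤ 8 * ((n : ℝ) + 1) ^ 8 := by
  rw [paramSpace, mem_closedBall_zero_iff] at hW
  have hm0 : 0 < m := by linarith
  set N : ℝ := (n : ℝ) + 1 with hN
  have hN1 : 1 ≤ N := by rw [hN]; linarith [Nat.cast_nonneg (α := ℝ) n]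
  have hN0 : 0 < N := by linarith
  have hθ0 : 0 < θ := lt_of_lt_of_le (by positivity) hθ
  refine (norm_stochGrad_le (by positivity) hθ0 hθ1 W G s).trans ?_
  rw [← hN]
  have h1 : 1 / (4 * m * N) / θ * n ≤ N ^ 5 := by
    calc 1 / (4 * m * N) / θ * n ≤ 1 / (4 * m * N) / (1 / (4 * m * N ^ 5)) * N := by
          gcongr
          rw [hN]; linarith
      _ = N ^ 5 := by field_simp
  have h2 : 2 * (1 / (4 * m * N)) * (N ^ 3 * ‖W‖) ≤ 2 * N ^ 4 := by
    calc 2 * (1 / (4 * m * N)) * (N ^ 3 * ‖W‖)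
        ≤ 2 * (1 / (4 * m * N)) * (N ^ 3 * (4 * m * N ^ 2)) := by gcongr
      _ = 2 * N ^ 4 := by field_simp
  have h3 : N ^ 3 ≤ N ^ 5 := pow_le_pow_right₀ hN1 (by norm_num)
  have h4 : N ^ 4 ≤ N ^ 5 := pow_le_pow_right₀ hN1 (by norm_num)
  calc (N ^ 3 + (1 / (4 * m * N) / θ * n + 2 * (1 / (4 * m * N)) * (N ^ 3 * ‖W‖))) * (2 * N ^ 3)
      ≤ (4 * N ^ 5) * (2 * N ^ 3) := by
        gcongr
        linarith
    _ = 8 * N ^ 8 := by ring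

/-- Convergence of projected SGD on the regularized loss, for any continuous function dominated by
the regularized loss up to an additive constant. -/
lemma sgdAverage_le_regLoss_target {m C M N : ℝ} (hm : 1 ≤ m) (hN : N = (n : ℝ) + 1)
    (hC : C = 128 * m ^ 2 * N ^ 11) (hM : M = 8 * N ^ 8) (R : Measure (Instance n))
    [IsProbabilityMeasure R] {F : Param n → ℝ} (hF : Continuous F) {r : ℝ}
    (hFr : ∀ W, F W ≤ regLoss (1 / (4 * m * N ^ 5)) (1 / (4 * m * N ^ 5)) (1 / (4 * m * N)) R W + r)
    {W₀ : Param n} (hW₀ : W₀ ∈ paramSpace n (4 * m * N ^ 2)) {T : ℕ}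
    (hT : 64 * C ^ 2 * (4 * m * N ^ 2) ^ 2 * M ^ 2 * m ^ 2 ≤ T) :
    sgdAverage (1 / (4 * m * N ^ 5)) (1 / (4 * m * N ^ 5)) (1 / (4 * m * N)) (4 * m * N ^ 2)
        (1 / (4 * C * M ^ 2 * m)) R T F W₀
      ≤ regLoss (1 / (4 * m * N ^ 5)) (1 / (4 * m * N ^ 5)) (1 / (4 * m * N)) R
          (target n (1 / (4 * m * N))) + 1 / (2 * m) + r := by
  have hm0 : 0 < m := by linarith
  have hN1 : 1 ≤ N := by rw [hN]; linarith [Nat.cast_nonneg (α := ℝ) n]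
  have hN0 : 0 < N := by linarith
  have hnN : (n : ℝ) ≤ N := by rw [hN]; linarith
  have hC0 : 0 < C := by rw [hC]; positivity
  have hM0 : 0 < M := by rw [hM]; positivity
  set lam : ℝ := 1 / (4 * m * N) with hlam
  set β : ℝ := 1 / (4 * m * N ^ 5) with hβ
  set B : ℝ := 4 * m * N ^ 2 with hB
  set η : ℝ := 1 / (4 * C * M ^ 2 * m) with hη
  have hl0 : 0 < lam := by positivity
  have hβ0 : 0 < β := by positivity
  have hB0 : 0 < B := by positivity
  have hη0 : 0 < η := by positivity
  have hβ1 : β < 1 := by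
    rw [hβ, div_lt_one (by positivity)]
    nlinarith [one_le_mul_of_one_le_of_one_le hm (one_le_pow₀ hN1 (n := 5))]
  have hw : target n lam ∈ paramSpace n B := by
    rw [hlam, hB, hN]
    exact target_mem_paramSpace n hm
  set w := target n lam
  -- The quasar-convexity constant for `τ = N` and `ρ = β`. The larger `C`, with `n` replaced by
  -- `N`, stays positive at `n = 0`.
  set C₀ : ℝ := 8 * (n : ℝ) ^ 2 / (N * β * β) with hC₀
  have hC₀0 : 0 ≤ C₀ := by positivity
  have hC₀C : C₀ ≤ C := by
    calc C₀ ≤ 8 * N ^ 2 / (N * β * β) := by rw [hC₀]; gcongr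
      _ = C := by
        rw [hC, hβ]
        field_simp
        ring
  have hV : Continuous fun W : Param n => ‖W - w‖ ^ 2 :=
    ((continuous_id.sub continuous_const).norm).pow 2
  have hstep : ∀ W ∈ paramSpace n B, F W ≤ (regLoss β β lam R w + lam * N + C₀ * (η * M ^ 2 / 2) + r)
      + C₀ / (2 * η) * (‖W - w‖ ^ 2 - sgdStep β β lam B η R (fun V => ‖V - w‖ ^ 2) W) := by
    intro W hW
    have hWB : ‖W‖ ≤ B := mem_closedBall_zero_iff.1 hW
    -- The choice of `β` makes `β * N ^ 3 * B` exactly `1`, the condition for the slow component to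
    -- be near uniform on the ball.
    have h1 := regLoss_sub_target_le hl0 hβ0 hβ1 hβ0 hN0 R W (by
      rw [← hN]
      calc β * (N ^ 3 * ‖W‖) ≤ β * (N ^ 3 * B) := by gcongr
        _ = 1 := by rw [hβ, hB]; field_simp
        _ ≤ 1 := le_rfl)
    have h2 := sgdStep_sq_dist_le (ρ := β) (lam := lam) (η := η) (M := M) hβ0.le hβ1.le hB0 R hw
      (W := W)
      (fun G s => by
        rw [hM, hlam, hN]
        rw [hB, hN] at hW
        exact norm_stochGrad_le_pow hm (by rw [← hN, ← hβ]; exact hβ1.le) le_rfl hW G s)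
      (fun G s => by
        have hb := hβ1.le
        rw [hM, hlam, hN]
        rw [hB, hN] at hW
        exact norm_stochGrad_le_pow hm (by rw [← hN]) hb hW G s)
    have h3 : inner ℝ (sampleMean β β R W (stochGrad lam W)) (W - w) ≤ η * M ^ 2 / 2
        + 1 / (2 * η) * (‖W - w‖ ^ 2 - sgdStep β β lam B η R (fun V => ‖V - w‖ ^ 2) W) := by
      have h4 : η * M ^ 2 / 2 = 1 / (2 * η) * (η ^ 2 * M ^ 2) := by field_simp
      rw [h4, ← mul_add, one_div, ← div_eq_inv_mul, le_div_iff₀ (by positivity)]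
      linarith
    have h5 := mul_le_mul_of_nonneg_left h3 hC₀0
    have h6 := hFr W
    rw [mul_add, ← mul_assoc, mul_one_div] at h5
    linarith
  have hT0 : (0 : ℝ) < T := lt_of_lt_of_le (by positivity) hT
  refine (sgdAverage_le hβ0.le hβ1.le hB0 R hF hV (D := (2 * B) ^ 2) (by positivity)
    (fun W _ => by positivity) (fun W hW => ?_) hstep (by exact_mod_cast hT0) hW₀).trans ?_
  · have h1 := norm_sub_le W w
    have h2 : ‖W‖ ≤ B := mem_closedBall_zero_iff.1 hW
    have h3 : ‖w‖ ≤ B := mem_closedBall_zero_iff.1 hw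
    have h4 : ‖W - w‖ ≤ 2 * B := by linarith
    gcongr
  -- Error budget: `1 / (4 * m)` from `τ`, and `1 / (8 * m)` each from the gradient noise and the
  -- initial distance, which fix `η` and `T`.
  · have e1 : lam * N = 1 / (4 * m) := by rw [hlam]; field_simp
    have e2 : C₀ * (η * M ^ 2 / 2) ≤ 1 / (8 * m) := by
      calc C₀ * (η * M ^ 2 / 2) ≤ C * (η * M ^ 2 / 2) := by gcongr
        _ = 1 / (8 * m) := by rw [hη]; field_simp; norm_num
    have e3 : C₀ / (2 * η) * (2 * B) ^ 2 / T ≤ 1 / (8 * m) := by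
      calc C₀ / (2 * η) * (2 * B) ^ 2 / T
          ≤ C / (2 * η) * (2 * B) ^ 2 / (64 * C ^ 2 * B ^ 2 * M ^ 2 * m ^ 2) := by gcongr
        _ = 1 / (8 * m) := by rw [hη]; field_simp; norm_num
    have e4 : 1 / (4 * m) + 1 / (8 * m) + 1 / (8 * m) = 1 / (2 * m) := by field_simp; norm_num
    linarith

/-- With `ρ = β` the two entropy weights add up to at most `2`. -/
lemma loss_le_regLoss_add {β lam : ℝ} (hl : 0 < lam) (hβ : 0 < β) (hβ1 : β < 1)
    (R : Measure (Instance n)) [IsProbabilityMeasure R] (W : Param n) :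
    loss β β R W ≤ regLoss β β lam R W + 2 * (lam * n) := by
  have h := mul_le_mul_of_nonneg_left (neg_le_regularizer hβ hβ1 hβ R W) hl.le
  rw [div_self hβ.ne'] at h
  rw [regLoss]
  linarith

lemma regLoss_le_loss {β ρ lam : ℝ} (hl : 0 < lam) (hβ : 0 < β) (hβ1 : β < 1) (hρ : 0 < ρ)
    (R : Measure (Instance n)) (W : Param n) : regLoss β ρ lam R W ≤ loss β ρ R W := by
  have h := mul_nonpos_of_nonneg_of_nonpos hl.le (regularizer_nonpos hβ hβ1 hρ R W)
  rw [regLoss]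
  linarith

end

end MaxCutGen

open MaxCutGen in
theorem mainTheorem5 :
    -- one constant for all polynomial bounds, independent of `n`, the prior and `ε`
    ∃ K : ℕ, ∀ (n : ℕ) (R : MeasureTheory.Measure (MaxCutGen.Instance n))
      [MeasureTheory.IsProbabilityMeasure R] (ε : ℝ), 0 < ε →
      ∃ (β ρ B : ℚ) (lam : ℝ),
        0 < β ∧ β < 1 ∧ 0 < ρ ∧ ρ < 1 ∧ 0 < B ∧ 0 < lam ∧
        -- compressed
        (∀ δ : NNReal, 0 < δ → ∃ b : ℕ, MaxCutGen.DescribedBy n β ρ B δ b ∧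
          (b : ℝ) ≤ K * ((n : ℝ) + 1) ^ K * (1 + Real.log (1 + 1 / ε)) ^ K
            * (1 + Real.log (1 + 1 / (δ : ℝ))) ^ K) ∧
        -- the stochastic gradient is an unbiased estimate of the gradient of the regularized loss
        (∀ W : MaxCutGen.Param n,
          HasGradientAt (MaxCutGen.regLoss (β : ℝ) (ρ : ℝ) lam R)
            (MaxCutGen.sampleMean (β : ℝ) (ρ : ℝ) R W (MaxCutGen.stochGrad lam W)) W) ∧
        ∃ Wbar ∈ MaxCutGen.paramSpace n (B : ℝ),
          -- complete
          MaxCutGen.loss (β : ℝ) (ρ : ℝ) R Wbar ≤ MaxCutGen.opt R + ε ∧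
          -- efficiently optimizable by projected SGD on the regularized loss
          IsMinOn (MaxCutGen.regLoss (β : ℝ) (ρ : ℝ) lam R)
            (MaxCutGen.paramSpace n (B : ℝ)) Wbar ∧
          ∃ (η : ℝ) (T₀ : ℕ), 0 < η ∧ 0 < T₀ ∧
            (T₀ : ℝ) ≤ K * (((n : ℝ) + 1) * (1 + 1 / ε)) ^ K ∧
            ∀ W₀ ∈ MaxCutGen.paramSpace n (B : ℝ), ∀ T : ℕ, T₀ ≤ T →
              MaxCutGen.sgdAverage (β : ℝ) (ρ : ℝ) lam (B : ℝ) η R T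
                  (MaxCutGen.regLoss (β : ℝ) (ρ : ℝ) lam R) W₀
                ≤ MaxCutGen.regLoss (β : ℝ) (ρ : ℝ) lam R Wbar + ε ∧
              MaxCutGen.sgdAverage (β : ℝ) (ρ : ℝ) lam (B : ℝ) η R T
                  (MaxCutGen.loss (β : ℝ) (ρ : ℝ) R) W₀
                ≤ MaxCutGen.loss (β : ℝ) (ρ : ℝ) R Wbar + ε := by
  
  -- `K` is kept opaque, so powers with exponent `K` are never evaluated. It must exceed the
  -- coefficient `2 ^ 38` and the exponent `42` in the bound for `T₀`.
  obtain ⟨K, hK⟩ : ∃ K : ℕ, 2 ^ 40 ≤ K := ⟨_, le_rfl⟩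
  have hK42 : 42 ≤ K := le_trans (by norm_num) hK
  have hKR : (2 : ℝ) ^ 40 ≤ K := by exact_mod_cast hK
  refine ⟨K, fun n R _ ε hε => ?_⟩
  -- An integer stand-in for `1 / ε`, so that `β`, `ρ` and `B` are rationals with short encodings.
  set m : ℕ := ⌈1 / ε⌉₊ + 1 with hm
  have hm1 : 1 ≤ m := by omega
  have hmR : (1 : ℝ) ≤ m := by exact_mod_cast hm1
  have hm0 : (0 : ℝ) < m := by linarith
  have hε0 : 0 < 1 / ε := one_div_pos.2 hε
  have hmε : 1 / (m : ℝ) ≤ ε := by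
    rw [one_div_le hm0 hε, hm]
    push_cast
    linarith [Nat.le_ceil (1 / ε)]
  have hmE : (m : ℝ) ≤ 2 * (1 + 1 / ε) := by
    rw [hm]
    push_cast
    linarith [Nat.ceil_lt_add_one hε0.le]
  set N : ℝ := (n : ℝ) + 1 with hN
  have hN1 : 1 ≤ N := by rw [hN]; linarith [Nat.cast_nonneg (α := ℝ) n]
  have hN0 : 0 < N := by linarith
  have hβ : ((1 / ((4 * m * (n + 1) ^ 5 : ℕ) : ℚ) : ℚ) : ℝ) = 1 / (4 * m * N ^ 5) := by
    push_cast
    rfl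
  have hB : (((4 * m * (n + 1) ^ 2 : ℕ) : ℚ) : ℝ) = 4 * m * N ^ 2 := by
    push_cast
    rfl
  have hmN : 1 ≤ (m : ℝ) * N ^ 5 := one_le_mul_of_one_le_of_one_le hmR (one_le_pow₀ hN1)
  have hβ0 : (0 : ℝ) < 1 / (4 * m * N ^ 5) := by positivity
  have hβ1 : 1 / (4 * m * N ^ 5) < 1 := by
    rw [div_lt_one (by positivity)]
    linarith
  have hβq0 : (0 : ℚ) < 1 / ((4 * m * (n + 1) ^ 5 : ℕ) : ℚ) := by
    rw [← hβ] at hβ0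
    exact_mod_cast hβ0
  have hβq1 : 1 / ((4 * m * (n + 1) ^ 5 : ℕ) : ℚ) < 1 := by
    rw [← hβ] at hβ1
    exact_mod_cast hβ1
  have hl : (0 : ℝ) < 1 / (4 * m * N) := by positivity
  have hln : 2 * (1 / (4 * m * N) * (n : ℝ)) ≤ 1 / (2 * m) := by
    calc 2 * (1 / (4 * m * N) * (n : ℝ)) ≤ 2 * (1 / (4 * m * N) * N) := by
          gcongr
          rw [hN]
          linarith
      _ = 1 / (2 * m) := by
          field_simp
          norm_num
  have hhalf : 1 / (2 * (m : ℝ)) + 1 / (2 * m) = 1 / m := by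
    field_simp
    norm_num
  have hhalf0 : 0 < 1 / (2 * (m : ℝ)) := by positivity
  have hloss : ∀ W : Param n, loss (1 / (4 * m * N ^ 5)) (1 / (4 * m * N ^ 5)) R W
      ≤ regLoss (1 / (4 * m * N ^ 5)) (1 / (4 * m * N ^ 5)) (1 / (4 * m * N)) R W
        + 1 / (2 * m) := fun W =>
    (loss_le_regLoss_add hl hβ0 hβ1 R W).trans (by linarith)
  refine ⟨1 / ((4 * m * (n + 1) ^ 5 : ℕ) : ℚ), 1 / ((4 * m * (n + 1) ^ 5 : ℕ) : ℚ),
    ((4 * m * (n + 1) ^ 2 : ℕ) : ℚ), 1 / (4 * m * N), hβq0, hβq1, hβq0, hβq1,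
    by positivity, hl, fun δ hδ => ?_, fun W => hasGradientAt_regLoss _ _ _ R W,
    target n (1 / (4 * m * N)), ?_⟩
  · obtain ⟨b, hb, hle⟩ := exists_describedBy n hm1 hδ
    refine ⟨b, hb, hle.trans ?_⟩
    have hδ' : (0 : ℝ) < δ := hδ
    have hLe : 0 ≤ Real.log (1 + 1 / ε) := Real.log_nonneg (by linarith)
    have hLd : 0 ≤ Real.log (1 + 1 / (δ : ℝ)) :=
      Real.log_nonneg (by linarith [one_div_pos.2 hδ'])
    have hLm : 1 + Real.log m ≤ 2 * (1 + Real.log (1 + 1 / ε)) := by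
      have h1 := Real.log_le_log hm0 hmE
      rw [Real.log_mul (by norm_num) (by positivity)] at h1
      linarith [Real.log_two_lt_d9]
    have hLm0 : 0 ≤ 1 + Real.log m := by linarith [Real.log_nonneg hmR]
    have h77 : (77 : ℝ) * 2 ≤ K := le_trans (by norm_num) hKR
    calc 77 * N ^ 5 * (1 + Real.log m) * (1 + Real.log (1 + 1 / (δ : ℝ)))
        ≤ 77 * N ^ 5 * (2 * (1 + Real.log (1 + 1 / ε))) * (1 + Real.log (1 + 1 / (δ : ℝ))) := by
          gcongr
      _ = 77 * 2 * N ^ 5 * (1 + Real.log (1 + 1 / ε)) ^ 1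
          * (1 + Real.log (1 + 1 / (δ : ℝ))) ^ 1 := by ring
      _ ≤ K * N ^ K * (1 + Real.log (1 + 1 / ε)) ^ K
          * (1 + Real.log (1 + 1 / (δ : ℝ))) ^ K := by
          gcongr
          · omega
          · linarith
          · omega
          · linarith
          · omega
  · simp only [hβ, hB]
    refine ⟨target_mem_paramSpace n hmR, ?_, fun W _ => regLoss_target_le hl hβ0 hβ1 hβ0 R W, ?_⟩
    · have h1 := hloss (target n (1 / (4 * m * N)))
      have h2 := regLoss_target_le_opt hl hβ0 hβ1 hβ0 R
      linarith
    refine ⟨1 / (4 * (128 * m ^ 2 * N ^ 11) * (8 * N ^ 8) ^ 2 * m),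
      64 * (128 * m ^ 2 * (n + 1) ^ 11) ^ 2 * (4 * m * (n + 1) ^ 2) ^ 2 * (8 * (n + 1) ^ 8) ^ 2
        * m ^ 2, by positivity, by positivity, ?_, fun W₀ hW₀ T hT => ?_⟩
    · push_cast
      rw [← hN]
      calc 64 * (128 * (m : ℝ) ^ 2 * N ^ 11) ^ 2 * (4 * m * N ^ 2) ^ 2 * (8 * N ^ 8) ^ 2 * m ^ 2
          = 2 ^ 30 * m ^ 8 * N ^ 42 := by ring
        _ ≤ 2 ^ 30 * (2 * (1 + 1 / ε)) ^ 8 * N ^ 42 := by gcongr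
        _ = 2 ^ 38 * ((1 + 1 / ε) ^ 8 * N ^ 42) := by ring
        _ ≤ 2 ^ 38 * ((1 + 1 / ε) ^ 42 * N ^ 42) := by
            gcongr
            · linarith
            · norm_num
        _ = 2 ^ 38 * (N * (1 + 1 / ε)) ^ 42 := by rw [mul_pow, mul_comm (N ^ 42)]
        _ ≤ K * (N * (1 + 1 / ε)) ^ K := by
            gcongr
            · exact le_trans (by norm_num) hKR
            · exact one_le_mul_of_one_le_of_one_le hN1 (by linarith)
    · have hT' : 64 * (128 * (m : ℝ) ^ 2 * N ^ 11) ^ 2 * (4 * m * N ^ 2) ^ 2 * (8 * N ^ 8) ^ 2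
          * m ^ 2 ≤ T := by
        have h : ((64 * (128 * m ^ 2 * (n + 1) ^ 11) ^ 2 * (4 * m * (n + 1) ^ 2) ^ 2
          * (8 * (n + 1) ^ 8) ^ 2 * m ^ 2 : ℕ) : ℝ) ≤ T := Nat.cast_le.2 hT
        push_cast at h
        exact h
      constructor
      · have h := sgdAverage_le_regLoss_target hmR hN rfl rfl R
          (continuous_regLoss (1 / (4 * m * N ^ 5)) (1 / (4 * m * N ^ 5)) (1 / (4 * m * N)) R)
          (r := 0) (fun W => by rw [add_zero]) hW₀ hT'
        linarith
      -- One `1 / (2 * m)` pays for optimization and one for the entropy; at the target, the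
      -- regularized loss is below the loss.
      · have h := sgdAverage_le_regLoss_target hmR hN rfl rfl R
          (continuous_loss (1 / (4 * m * N ^ 5)) (1 / (4 * m * N ^ 5)) R) hloss hW₀ hT'
        have h1 := regLoss_le_loss hl hβ0 hβ1 hβ0 R (target n (1 / (4 * m * N)))
        linarith
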